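/- Let $n\ge 1$ and let $M$ be a compact smooth $n$-dimensional manifold with boundary, with a smooth Riemannian metric $g$ and a smooth real one-form $\omega$. Let $F:TM\to TM$ be the bundle map with $g(F(v),w)=d\omega(v,w)$ (that is, $F^i{}_j=-(d\omega)^i{}_j$). A unit speed magnetic geodesic is a curve $x$ in $M$ with $|\dot x|_g=1$ and $\nabla_{\dot x}\dot x=F(\dot x)$. Assume that - the magnetic flow is non-trapping: for every unit vector $(x,v)\in SM$ the magnetic geodesic $\gamma_{x,v}$ with $\gamma_{x,v}(0)=x$, $\dot\gamma_{x,v}(0)=v$ has a compact maximal interval of definition $[\sigma(x,v),\kappa(x,v)]\ni 0$ in $M$; - the boundary is strictly magnetic convex: $\Pi_x(v,v)>g_x(F_x(v),\nu(x))$ for all $x\in\partial M$ and all unit vectors $v\in T_x\partial M$, where $\nu$ is the inward unit normal and $\Pi_x(v,v)=g(\nabla_v v,\nu)$ is the second fundamental form. Equip $\mathbb R\times M$ with the Lorentzian metric $\overline g=-(dt+\omega)^2+g$, with $\partial_t$ future-directed, and let $\overline A=\Phi\,dt+\tilde A$ be a time-independent connection form, where $\Phi\in C^\infty(M;\mathbb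 C^{N\times N})$ and $\tilde A$ is a smooth $\mathbb C^{N\times N}$-valued one-form on $M$. Put $\mathcal A(x,v)=\Phi(x)+\tilde A_x(v)-\omega_x(v)\Phi(x)$ for $(x,v)\in SM$. For $V\in C^\infty_0(M;\mathbb C^{N\times N})$ with $\operatorname{supp}V\subset\operatorname{Int}M$, and for $(x,v)\in\partial_+SM$ (unit vectors at boundary points that point inwards or are tangent to $\partial M$), let $$I_{\mathcal A}V(x,v)=\int_0^{\kappa(x,v)}P(s)^{-1}\,V(\gamma_{x,v}(s))\,P(s)\,ds,\qquad P'+\mathcal A(\gamma_{x,v},\dot\gamma_{x,v})P=0,\quad P(0)=\mathrm{Id}.$$ For $Q\in C^\infty_0(\mathbb R\times M;\mathbb C^{N\times N})$ with $\operatorname{supp}Q\subset\mathbb R\times\operatorname{Int}M$, and for a maximal future-directed null geodesic $\gamma:[0,l]\to\mathbb R\times M$ of $\overline g$, let $$\mathcal L_{\overline A}Q(\gamma)=\int_0^{l}P(s)^{-1}\,Q(\gamma(s))\,P(s)\,ds,\qquad P'+\overline A(\dot\gamma)P=0,\quad P(0)=\mathrm{Id}.$$ Suppose that $I_{\mathcal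 A}$ is injective, that is, for all $V$ as above, $I_{\mathcal A}V=0$ on $\partial_+SM$ implies $V=0$. Then $\mathcal L_{\overline A}$ is injective: for all $Q$ as above, if $\mathcal L_{\overline A}Q(\gamma)=0$ for every maximal future-directed null geodesic $\gamma$, then $Q=0$. -/

import Mathlib

open Set Bundle
open scoped Manifold ContDiff

noncomputable section

namespace LightRay

/-! ### Coordinate expressions on a manifold, possibly with boundary -/

section Coordinates

variable {E : Type*} [NormedAddCommGroup E] [NormedSpace ℝ E]
  {H : Type*} [TopologicalSpace H] (I : ModelWithCorners ℝ E H)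
  {M : Type*} [TopologicalSpace M] [ChartedSpace H M] [IsManifold I 1 M]

/-- The tangent vector at `x` whose components in the coordinates of the chart at `p` are `w`. -/
def coordVec (p x : M) (w : E) : TangentSpace I x :=
  (trivializationAt E (TangentSpace I : M → Type _) p).symmL ℝ x w

/-- The components of a tangent vector in the coordinates of the chart at `p`. -/
def components (p : M) (v : TangentBundle I M) : E :=
  (trivializationAt E (TangentSpace I : M → Type _) p v).2

/-- `∂_u (g (v, w))` at `p`, where `v` and `w` are extended with constant components in the
coordinates of the chart at `p`. -/
def dMetric (g : ∀ x : M, TangentSpace I x → TangentSpace I x → ℝ) (p : M)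
    (u v w : TangentSpace I p) : ℝ :=
  fderivWithin ℝ
    (fun y : E => g ((extChartAt I p).symm y) (coordVec I p ((extChartAt I p).symm y) v)
      (coordVec I p ((extChartAt I p).symm y) w))
    (range I) (extChartAt I p p) u

/-- The Christoffel symbols of the first kind of the (pseudo-)Riemannian metric `g` at `p`:
`Γ(u, v; w) = g (∇_u v, w)`, where `∇` is the Levi-Civita connection and `v` is extended with
constant components in the coordinates of the chart at `p`. -/
def christoffel (g : ∀ x : M, TangentSpace I x → TangentSpace I x → ℝ) (p : M)
    (u v w : TangentSpace I p) : ℝ :=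
  (dMetric I g p u v w + dMetric I g p v u w - dMetric I g p w u v) / 2

/-- The exterior derivative `dω (u, v) = ∂_u (ω v) - ∂_v (ω u)` of a one-form at `p`, in the
coordinates of the chart at `p`. -/
def dForm (om : ∀ x : M, TangentSpace I x → ℝ) (p : M) (u v : TangentSpace I p) : ℝ :=
  fderivWithin ℝ
      (fun y : E => om ((extChartAt I p).symm y) (coordVec I p ((extChartAt I p).symm y) v))
      (range I) (extChartAt I p p) u -
    fderivWithin ℝ
      (fun y : E => om ((extChartAt I p).symm y) (coordVec I p ((extChartAt I p).symm y) u))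
      (range I) (extChartAt I p p) v

/-- The curve `γ` in the tangent bundle is, on the interval `[a, b]`, the velocity lift of its
projection to `M`: the derivative of `s ↦ (γ s).proj` is `γ s`. (On a one-point interval this
allows any initial velocity.) -/
def IsVelocityLift (a b : ℝ) (γ : ℝ → TangentBundle I M) : Prop :=
  ∀ s ∈ Icc a b, HasMFDerivWithinAt 𝓘(ℝ, ℝ) I (fun r => (γ r).proj) (Icc a b) s
    ((1 : ℝ →L[ℝ] ℝ).smulRight (γ s).2)

/-- At the parameter `s`, the covariant acceleration `∇_ẋ ẋ` of the curve `x` with velocity lift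
`γ : [a, b] → TM` satisfies `g (∇_ẋ ẋ, w) = θ w` for all tangent vectors `w`. In coordinates,
`g (∇_ẋ ẋ, w) = g (ẍ, w) + Γ(ẋ, ẋ; w)`. -/
def HasLoweredAcceleration (g : ∀ x : M, TangentSpace I x → TangentSpace I x → ℝ)
    (a b : ℝ) (γ : ℝ → TangentBundle I M) (s : ℝ)
    (θ : TangentSpace I (γ s).proj → ℝ) : Prop :=
  ∃ acc : E, HasDerivWithinAt (fun r => components I (γ s).proj (γ r)) acc (Icc a b) s ∧
    ∀ w : TangentSpace I (γ s).proj,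
      g (γ s).proj acc w + christoffel I g (γ s).proj (γ s).2 (γ s).2 w = θ w

/-- `γ` is, on `[a, b]`, the velocity lift of a geodesic of the (pseudo-)Riemannian metric `g`. -/
def IsGeodesic (g : ∀ x : M, TangentSpace I x → TangentSpace I x → ℝ)
    (a b : ℝ) (γ : ℝ → TangentBundle I M) : Prop :=
  IsVelocityLift I a b γ ∧ ∀ s ∈ Icc a b, HasLoweredAcceleration I g a b γ s (fun _ => 0)

/-- A smooth one-form on `M` with values in the vector space `F`. -/
structure SmoothOneForm (F : Type*) [NormedAddCommGroup F] [NormedSpace ℝ F] where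
  /-- The value of the form at a point. -/
  toForm (x : M) : TangentSpace I x →L[ℝ] F
  contMDiff : ContMDiff I (I.prod 𝓘(ℝ, E →L[ℝ] F)) ∞
    (fun x => TotalSpace.mk' (E →L[ℝ] F)
      (E := fun x : M => TangentSpace I x →L[ℝ] Bundle.Trivial M F x) x (toForm x))

/-- A matrix-valued function on `M` with smooth entries. -/
def IsSmoothMat {N : ℕ} (V : M → Matrix (Fin N) (Fin N) ℂ) : Prop :=
  ∀ i j, ContMDiff I 𝓘(ℝ, ℂ) ∞ (fun x => V x i j)

end Coordinates

/-- Among the curves that satisfy `P a b` on an interval `[a, b]`, the curve `γ` on `[a, b]` is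
maximal: it has no continuation to a larger interval. -/
def IsMaximalCurve {X : Type*} (P : ℝ → ℝ → (ℝ → X) → Prop) (a b : ℝ) (γ : ℝ → X) : Prop :=
  a ≤ b ∧ P a b γ ∧ ∀ (a' b' : ℝ) (γ' : ℝ → X), a' ≤ a → b ≤ b' → P a' b' γ' →
    EqOn γ γ' (Icc a b) → a' = a ∧ b' = b

/-- `N × N` complex matrices. -/
abbrev Mat (N : ℕ) : Type := Matrix (Fin N) (Fin N) ℂ

/-- `P` is the fundamental matrix solution of `P' + α P = 0`, `P 0 = Id`, on `[0, l]`. -/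
def IsParallelTransport {N : ℕ} (α : ℝ → Mat N) (l : ℝ) (P : ℝ → Mat N) : Prop :=
  P 0 = 1 ∧ ∀ s ∈ Icc 0 l, ∀ i j,
    HasDerivWithinAt (fun r => P r i j) (-(α s * P s) i j) (Icc 0 l) s

/-- The integral `∫₀^l P⁻¹ q P ds`, taken entry by entry. -/
def conjIntegral {N : ℕ} (l : ℝ) (P q : ℝ → Mat N) : Mat N :=
  Matrix.of fun i j => ∫ s in (0 : ℝ)..l, ((P s)⁻¹ * q s * P s) i j

/-! ### Magnetic systems on a compact manifold with boundary -/

section Magnetic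

variable {n : ℕ} [NeZero n] {M : Type*} [TopologicalSpace M]
  [ChartedSpace (EuclideanHalfSpace n) M] [IsManifold (𝓡∂ n) ∞ M]

/-- Smooth Riemannian metrics on the manifold with boundary `M`. -/
abbrev Metric (n : ℕ) [NeZero n] (M : Type*) [TopologicalSpace M]
    [ChartedSpace (EuclideanHalfSpace n) M] [IsManifold (𝓡∂ n) ∞ M] :=
  ContMDiffRiemannianMetric (𝓡∂ n) ∞ (EuclideanSpace ℝ (Fin n))
    (fun x : M => TangentSpace (𝓡∂ n) x)

-- The magnetic system: `g` is the Riemannian metric, `om` is the one-form `ω`.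
variable (g : Metric n M) (om : SmoothOneForm (𝓡∂ n) (M := M) ℝ)

/-- The metric as a family of real-valued functions. -/
def metricFun (x : M) (u v : TangentSpace (𝓡∂ n) x) : ℝ := g.inner x u v

/-- `γ` is, on `[a, b]`, the velocity lift of a unit speed magnetic geodesic of `(g, ω)`, that is,
a solution of the Lorentz force equation `∇_ẋ ẋ = F(ẋ)` with `F^i_j = -(dω)^i_j`; lowering the
index, `g (F v, w) = -dω (w, v) = dω (v, w)`. -/
def IsMagneticGeodesic (a b : ℝ) (γ : ℝ → TangentBundle (𝓡∂ n) M) : Prop :=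
  IsVelocityLift (𝓡∂ n) a b γ ∧
  (∀ s ∈ Icc a b, g.inner (γ s).proj (γ s).2 (γ s).2 = 1) ∧
  ∀ s ∈ Icc a b, HasLoweredAcceleration (𝓡∂ n) (metricFun g) a b γ s
    (fun w => dForm (𝓡∂ n) (fun x v => om.toForm x v) (γ s).proj (γ s).2 w)

/-- Every unit vector is the initial value of a magnetic geodesic whose maximal interval of
definition is a compact interval `[σ, κ]`. -/
def NonTrapping : Prop :=
  ∀ z : TangentBundle (𝓡∂ n) M, g.inner z.proj z.2 z.2 = 1 →
    ∃ (σ κ : ℝ) (γ : ℝ → TangentBundle (𝓡∂ n) M), σ ≤ 0 ∧ 0 ≤ κ ∧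
      IsMaximalCurve (IsMagneticGeodesic g om) σ κ γ ∧ γ 0 = z

/-- For a boundary point `p`, the `0`-th component of a tangent vector at `p` in the boundary
chart at `p`: it is positive on inward, zero on boundary and negative on outward vectors. -/
def normalComponent {p : M} (v : TangentSpace (𝓡∂ n) p) : ℝ :=
  (id v : EuclideanSpace ℝ (Fin n)) 0

/-- `ν` is the inward unit normal of the boundary at `p`. -/
def IsInwardUnitNormal (p : M) (ν : TangentSpace (𝓡∂ n) p) : Prop :=
  g.inner p ν ν = 1 ∧ 0 < normalComponent ν ∧
    ∀ w : TangentSpace (𝓡∂ n) p, normalComponent w = 0 → g.inner p ν w = 0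

/-- Strict magnetic convexity of the boundary: `Π (v, v) > g (F v, ν)` for all unit vectors `v`
tangent to the boundary. The second fundamental form is `Π (v, v) = g (∇_v v, ν)`, where `v` is
extended tangentially to the boundary; the extension with constant components in the boundary
chart is of this kind, so that `Π (v, v) = Γ(v, v; ν)`. -/
def StrictlyMagneticConvex : Prop :=
  ∀ p ∈ (𝓡∂ n).boundary M, ∀ ν : TangentSpace (𝓡∂ n) p, IsInwardUnitNormal g p ν →
    ∀ v : TangentSpace (𝓡∂ n) p, normalComponent v = 0 → g.inner p v v = 1 →
      dForm (𝓡∂ n) (fun x u => om.toForm x u) p v ν <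
        christoffel (𝓡∂ n) (metricFun g) p v v ν

/-- The influx boundary `∂₊SM`, including the glancing vectors. -/
def influxBoundary : Set (TangentBundle (𝓡∂ n) M) :=
  {z | z.proj ∈ (𝓡∂ n).boundary M ∧ g.inner z.proj z.2 z.2 = 1 ∧ 0 ≤ normalComponent z.2}

/-! ### The two transforms -/

variable {N : ℕ} (Φ : M → Mat N)
  (A : Fin N → Fin N → SmoothOneForm (𝓡∂ n) (M := M) ℂ)

/-- The value on a tangent vector of the matrix-valued one-form with entries `A i j`. -/
def matrixForm (x : M) (v : TangentSpace (𝓡∂ n) x) : Mat N :=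
  Matrix.of fun i j => (A i j).toForm x v

/-- The matrix attenuation `𝒜(x, v) = Φ(x) + B(v)` with `B = A - Φ ω`. -/
def attenuation (z : TangentBundle (𝓡∂ n) M) : Mat N :=
  Φ z.proj + (matrixForm A z.proj z.2 - om.toForm z.proj z.2 • Φ z.proj)

/-- `I_𝒜 V = 0`. For every `(x, v) ∈ ∂₊SM`, with maximal magnetic geodesic
`γ : [σ, κ] → M`, `γ 0 = (x, v)`, and parallel transport `P` along it,
`∫₀^κ P⁻¹ V(γ) P ds = 0`. -/
def XRayVanishes (V : M → Mat N) : Prop :=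
  ∀ z ∈ influxBoundary g, ∀ (σ κ : ℝ) (γ : ℝ → TangentBundle (𝓡∂ n) M) (P : ℝ → Mat N),
    σ ≤ 0 → 0 ≤ κ → IsMaximalCurve (IsMagneticGeodesic g om) σ κ γ → γ 0 = z →
    IsParallelTransport (fun s => attenuation om Φ A (γ s)) κ P →
      conjIntegral κ P (fun s => V (γ s).proj) = 0

/-- Injectivity of the non-Abelian magnetic X-ray transform on smooth functions with support in
the interior of `M`. -/
def XRayInjective : Prop :=
  ∀ V : M → Mat N, IsSmoothMat (𝓡∂ n) V → HasCompactSupport V →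
    tsupport V ⊆ (𝓡∂ n).interior M → XRayVanishes g om Φ A V → V = 0

/-- The model of the spacetime cylinder `ℝ × M`. -/
abbrev cylModel (n : ℕ) [NeZero n] := (𝓘(ℝ, ℝ)).prod (𝓡∂ n)

/-- The component `dt(u)` of a tangent vector of `ℝ × M`. -/
def timePart {z : ℝ × M} (u : TangentSpace (cylModel n) z) : ℝ :=
  mfderiv (cylModel n) 𝓘(ℝ, ℝ) (Prod.fst : ℝ × M → ℝ) z u

/-- The projection to `TM` of a tangent vector of `ℝ × M`. -/
def spacePart {z : ℝ × M} (u : TangentSpace (cylModel n) z) : TangentSpace (𝓡∂ n) z.2 :=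
  mfderiv (cylModel n) (𝓡∂ n) (Prod.snd : ℝ × M → M) z u

/-- The one-form `dt + ω` on `ℝ × M`. -/
def dtAddOmega (z : ℝ × M) (u : TangentSpace (cylModel n) z) : ℝ :=
  timePart u + om.toForm z.2 (spacePart u)

/-- The ultrastationary Lorentzian metric `-(dt + ω)² + g` on `ℝ × M`. -/
def lorentzMetric (z : ℝ × M) (u w : TangentSpace (cylModel n) z) : ℝ :=
  -(dtAddOmega om z u * dtAddOmega om z w) + g.inner z.2 (spacePart u) (spacePart w)

/-- `γ` is, on `[a, b]`, the velocity lift of a future-directed null geodesic of `ℝ × M`.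
A non-zero null vector `u` is future-directed if its product with `∂_t`, which is
`-(dt + ω)(u)`, is negative. -/
def IsNullGeodesic (a b : ℝ) (γ : ℝ → TangentBundle (cylModel n) (ℝ × M)) : Prop :=
  IsGeodesic (cylModel n) (lorentzMetric g om) a b γ ∧
  ∀ s ∈ Icc a b, lorentzMetric g om (γ s).proj (γ s).2 (γ s).2 = 0 ∧
    0 < dtAddOmega om (γ s).proj (γ s).2

/-- The time-independent connection one-form `Φ dt + A` on `ℝ × M`. -/
def connection (u : TangentBundle (cylModel n) (ℝ × M)) : Mat N :=
  timePart u.2 • Φ u.proj.2 + matrixForm A u.proj.2 (spacePart u.2)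

/-- The light ray transform of `Q` vanishes. For every maximal null geodesic
`γ : [0, l] → ℝ × M`, with parallel transport `P` along it, `∫₀^l P⁻¹ Q(γ) P ds = 0`. -/
def LightRayVanishes (Q : ℝ × M → Mat N) : Prop :=
  ∀ (l : ℝ) (γ : ℝ → TangentBundle (cylModel n) (ℝ × M)) (P : ℝ → Mat N),
    IsMaximalCurve (IsNullGeodesic g om) 0 l γ →
    IsParallelTransport (fun s => connection Φ A (γ s)) l P →
      conjIntegral l P (fun s => Q (γ s).proj) = 0

/-- Injectivity of the non-Abelian light ray transform on smooth compactly supported functions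
with support in `ℝ × Int M`. -/
def LightRayInjective : Prop :=
  ∀ Q : ℝ × M → Mat N, IsSmoothMat (cylModel n) Q → HasCompactSupport Q →
    tsupport Q ⊆ univ ×ˢ (𝓡∂ n).interior M → LightRayVanishes g om Φ A Q → Q = 0

end Magnetic

end LightRay

end

noncomputable section

namespace LightRay

/-! ### Curves and one-forms in the coordinates of a chart. -/

section ChartCalculus

set_option linter.unusedSectionVars false

open Filter Topology

variable {E : Type*} [NormedAddCommGroup E] [NormedSpace ℝ E]
  {H : Type*} [TopologicalSpace H] {I : ModelWithCorners ℝ E H}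
  {M : Type*} [TopologicalSpace M] [ChartedSpace H M] [IsManifold I 1 M]

/-! Nothing depends on `t`, so `dt + ω` is constant along every geodesic of the Lorentzian metric.
Once it equals `1`, the remaining geodesic equation is the Lorentz force equation on `M`, and
nullness is unit speed. Conversely, a magnetic geodesic `x` lifts to null geodesics with time
coordinate `t₀ + h`, where `h' = 1 - ω(ẋ)` and `t₀` is arbitrary
(`IsMagneticGeodesic.isNullGeodesic`, `isMaximalCurve_nullLift`). The connection evaluated on the
lift is the attenuation (`connection_nullLift`), so the transport `P` is the same.

If the light ray transform of `Q` vanishes, then `∫ P⁻¹ Q(t₀ + h(s), x(s)) P ds = 0` for all `t₀`.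
Multiply by `t₀ ^ k` and integrate over `t₀`. If all moments of `Q` in time of order below `k`
vanish, the shift by `h(s)` leaves the `k`-th moment unchanged (`integral_pow_mul_shift`), so this
moment lies in the kernel of the X-ray transform (`LightRayVanishes.xRayVanishes_moment`). It is
smooth with support in the interior, hence zero by injectivity. By strong induction all moments
vanish, and a compactly supported continuous function of `t` with this property is zero by
Weierstrass approximation (`eq_zero_of_moments_eq_zero`).

Light rays are parametrised from `0`, so the lift must be maximal on `[0, κ]`. For a strictly inward
initial vector the geodesic has no past; for a glancing one strict convexity forces `κ = 0`, and the
X-ray integral is trivially zero. -/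

lemma coordVec_eq_tangentCoordChange {p x : M} (hx : x ∈ (chartAt H p).source) (w : E) :
    coordVec I p x w = tangentCoordChange I p x x w := by
  unfold coordVec
  rw [TangentBundle.symmL_trivializationAt_eq_core hx]
  rfl

lemma coordVec_self (p : M) (w : E) : coordVec I p p w = w :=
  (coordVec_eq_tangentCoordChange (mem_chart_source H p) w).trans
    (tangentCoordChange_self (I := I) (mem_extChartAt_source p))

lemma components_self (v : TangentBundle I M) : components I v.proj v = v.2 :=
  tangentCoordChange_self (E := E) (mem_extChartAt_source v.proj)

lemma coordVec_components {p : M} {v : TangentBundle I M} (hv : v.proj ∈ (chartAt H p).source) :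
    coordVec I p v.proj (components I p v) = v.2 := by
  have h : v.proj ∈ (extChartAt I p).source := by rwa [extChartAt_source]
  refine (coordVec_eq_tangentCoordChange hv _).trans ?_
  refine (tangentCoordChange_comp (I := I) (E := E)
    ⟨⟨mem_extChartAt_source v.proj, h⟩, mem_extChartAt_source v.proj⟩).trans ?_
  exact tangentCoordChange_self (E := E) (mem_extChartAt_source v.proj)

/-- A curve in `M` has velocity `v` if and only if it has so in the chart at its base point. -/
lemma hasMFDerivWithinAt_smulRight_iff {x : ℝ → M} {S : Set ℝ} {s : ℝ} {v : TangentSpace I (x s)} :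
    HasMFDerivWithinAt 𝓘(ℝ, ℝ) I x S s ((1 : ℝ →L[ℝ] ℝ).smulRight v) ↔
      ContinuousWithinAt x S s ∧
        HasDerivWithinAt (fun r => extChartAt I (x s) (x r)) (v : E) S s := by
  have e : (extChartAt 𝓘(ℝ, ℝ) s).symm ⁻¹' S ∩ range 𝓘(ℝ, ℝ) = S := by
    simp [chartAt_self_eq]
  have key : HasFDerivWithinAt (fun r => extChartAt I (x s) (x r))
      ((1 : ℝ →L[ℝ] ℝ).smulRight (v : E)) ((extChartAt 𝓘(ℝ, ℝ) s).symm ⁻¹' S ∩ range 𝓘(ℝ, ℝ)) s ↔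
      HasDerivWithinAt (fun r => extChartAt I (x s) (x r)) (v : E) S s := by
    rw [e]
    exact hasDerivWithinAt_iff_hasFDerivWithinAt.symm
  exact ⟨fun h => ⟨h.1, key.1 h.2⟩, fun h => ⟨h.1, key.2 h.2⟩⟩

lemma IsVelocityLift.continuousWithinAt {a b : ℝ} {γ : ℝ → TangentBundle I M}
    (h : IsVelocityLift I a b γ) {s : ℝ} (hs : s ∈ Icc a b) :
    ContinuousWithinAt (fun r => (γ r).proj) (Icc a b) s :=
  (h s hs).continuousWithinAt

lemma IsVelocityLift.continuousOn {a b : ℝ} {γ : ℝ → TangentBundle I M}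
    (h : IsVelocityLift I a b γ) : ContinuousOn (fun r => (γ r).proj) (Icc a b) :=
  fun _ hs => h.continuousWithinAt hs

lemma IsVelocityLift.eventually_mem_source {a b : ℝ} {γ : ℝ → TangentBundle I M}
    (h : IsVelocityLift I a b γ) {s : ℝ} (hs : s ∈ Icc a b) :
    ∀ᶠ r in 𝓝[Icc a b] s, (γ r).proj ∈ (chartAt H (γ s).proj).source :=
  (h.continuousWithinAt hs).eventually
    ((chartAt H (γ s).proj).open_source.mem_nhds (mem_chart_source H _))

/-- In any chart, the components of the velocity lift are the derivatives of the coordinates. -/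
lemma IsVelocityLift.hasDerivWithinAt_extChartAt {a b : ℝ} {γ : ℝ → TangentBundle I M}
    (h : IsVelocityLift I a b γ) {s : ℝ} (hs : s ∈ Icc a b) {p : M}
    (hp : (γ s).proj ∈ (chartAt H p).source) :
    HasDerivWithinAt (fun r => extChartAt I p (γ r).proj) (components I p (γ s)) (Icc a b) s := by
  have hs' := hasMFDerivWithinAt_smulRight_iff.1 (h s hs)
  have h' : (γ s).proj ∈ (extChartAt I p).source := by rwa [extChartAt_source]
  have h1 := (hasFDerivWithinAt_tangentCoordChange (I := I) ⟨mem_extChartAt_source (γ s).proj,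
    h'⟩).comp_hasDerivWithinAt s hs'.2 fun r _ =>
      mem_range_self (f := I) (chartAt H (γ s).proj (γ r).proj)
  refine h1.congr_of_eventuallyEq ?_ ?_
  · filter_upwards [h.eventually_mem_source hs] with r hr
    simp only [Function.comp]
    rw [(extChartAt I (γ s).proj).left_inv (by rwa [extChartAt_source])]
  · simp

variable {F : Type*} [NormedAddCommGroup F] [NormedSpace ℝ F]

/-- A one-form in the coordinates of the chart at `p`. -/
def localForm (om : ∀ x : M, TangentSpace I x →L[ℝ] F) (p : M) (y : E) : E →L[ℝ] F :=
  (om ((extChartAt I p).symm y)).comp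
    ((trivializationAt E (TangentSpace I : M → Type _) p).symmL ℝ ((extChartAt I p).symm y))

lemma localForm_apply (om : ∀ x : M, TangentSpace I x →L[ℝ] F) (p : M) (y : E) (w : E) :
    localForm om p y w =
      om ((extChartAt I p).symm y) (coordVec I p ((extChartAt I p).symm y) w) := rfl

lemma localForm_self (om : ∀ x : M, TangentSpace I x →L[ℝ] F) (p : M) (w : E) :
    localForm om p (extChartAt I p p) w = om p w := by
  rw [localForm_apply, extChartAt_to_inv, coordVec_self]

lemma localForm_components (om : ∀ x : M, TangentSpace I x →L[ℝ] F) {p : M}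
    {v : TangentBundle I M} (hv : v.proj ∈ (chartAt H p).source) :
    localForm om p (extChartAt I p v.proj) (components I p v) = om v.proj v.2 := by
  have h : v.proj ∈ (extChartAt I p).source := by rwa [extChartAt_source]
  rw [localForm_apply, (extChartAt I p).left_inv h, coordVec_components hv]

lemma differentiableWithinAt_comp_extChartAt_symm {f : M → F} {p : M}
    (hf : MDifferentiableAt I 𝓘(ℝ, F) f p) :
    DifferentiableWithinAt ℝ (fun y => f ((extChartAt I p).symm y)) (range I)
      (extChartAt I p p) :=
  hf.hasMFDerivAt.2.differentiableWithinAt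

/-- A section of the Hom bundle is smooth when its `inCoordinates` expression is. For a trivial
target this expression is precomposition with the inverse trivialization, which is `localForm`. -/
lemma SmoothOneForm.differentiableWithinAt_localForm (om : SmoothOneForm I (M := M) F) (p : M) :
    DifferentiableWithinAt ℝ (localForm om.toForm p) (range I) (extChartAt I p p) := by
  have h := (contMDiffAt_hom_bundle _).1 (om.contMDiff p)
  refine (differentiableWithinAt_comp_extChartAt_symm
    (h.2.mdifferentiableAt (by simp))).congr (fun y _ => ?_) ?_ <;>
  · ext w
    simp [localForm, ContinuousLinearMap.inCoordinates]
    rfl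

/-- The derivative at `p`, in the direction `u`, of the value of a one-form on the vector field with
constant components `v` in the chart at `p`. -/
def formDeriv (om : ∀ x : M, TangentSpace I x →L[ℝ] F) (p : M) (u v : E) : F :=
  fderivWithin ℝ (fun y => localForm om p y v) (range I) (extChartAt I p p) u

lemma SmoothOneForm.formDeriv_eq (om : SmoothOneForm I (M := M) F) (p : M) (u v : E) :
    formDeriv om.toForm p u v =
      fderivWithin ℝ (localForm om.toForm p) (range I) (extChartAt I p p) u v := by
  have h := (om.differentiableWithinAt_localForm p).hasFDerivWithinAt
  have h1 := h.clm_apply (hasFDerivWithinAt_const v (extChartAt I p p) (range I))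
  unfold formDeriv
  rw [h1.fderivWithin (I.uniqueDiffWithinAt_image)]
  simp

/-- The derivative along a curve of the value of a one-form on the velocity. -/
lemma SmoothOneForm.hasDerivWithinAt_velocity (om : SmoothOneForm I (M := M) F) {a b : ℝ}
    {γ : ℝ → TangentBundle I M} (h : IsVelocityLift I a b γ) {s : ℝ} (hs : s ∈ Icc a b) {acc : E}
    (hacc : HasDerivWithinAt (fun r => components I (γ s).proj (γ r)) acc (Icc a b) s) :
    HasDerivWithinAt (fun r => om.toForm (γ r).proj (γ r).2)
      (formDeriv om.toForm (γ s).proj (γ s).2 (γ s).2 + om.toForm (γ s).proj acc) (Icc a b) s := by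
  have hmem := mem_chart_source H (γ s).proj
  have h1 := (om.differentiableWithinAt_localForm (γ s).proj).hasFDerivWithinAt
  have h2 := h1.comp_hasDerivWithinAt s (h.hasDerivWithinAt_extChartAt hs hmem) fun r _ =>
      mem_range_self (f := I) (chartAt H (γ s).proj (γ r).proj)
  have h3 := h2.clm_apply hacc
  have e₁ : formDeriv om.toForm (γ s).proj (components I (γ s).proj (γ s))
      (components I (γ s).proj (γ s)) = formDeriv om.toForm (γ s).proj (γ s).2 (γ s).2 := by
    rw [components_self]
  have e₂ : localForm om.toForm (γ s).proj (extChartAt I (γ s).proj (γ s).proj) acc =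
    om.toForm (γ s).proj acc := localForm_self _ _ _
  refine (h3.congr_of_eventuallyEq ?_ ?_).congr_deriv
    (congrArg₂ (· + ·) ((om.formDeriv_eq _ _ _).symm.trans e₁) e₂)
  · filter_upwards [h.eventually_mem_source hs] with r hr
    exact (localForm_components om.toForm hr).symm
  · exact (localForm_components om.toForm hmem).symm

end ChartCalculus

/-! ### Charts, tangent vectors and velocities on `ℝ × M`. -/

section Product

open Filter Topology

set_option linter.unusedSectionVars false

variable {E : Type*} [NormedAddCommGroup E] [NormedSpace ℝ E]
  {H : Type*} [TopologicalSpace H] {I : ModelWithCorners ℝ E H}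
  {M : Type*} [TopologicalSpace M] [ChartedSpace H M] [IsManifold I 1 M]

lemma extChartAt_real_prod_apply (p z : ℝ × M) :
    extChartAt ((𝓘(ℝ, ℝ)).prod I) p z = (z.1, extChartAt I p.2 z.2) := by
  simp [chartAt_self_eq]

lemma extChartAt_real_prod_symm_apply (p : ℝ × M) (y : ℝ × E) :
    (extChartAt ((𝓘(ℝ, ℝ)).prod I) p).symm y = (y.1, (extChartAt I p.2).symm y.2) := by
  simp [chartAt_self_eq]
  rfl

lemma range_real_prod : range ((𝓘(ℝ, ℝ)).prod I) = (univ : Set ℝ) ×ˢ range I := by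
  rw [modelWithCorners_prod_coe, range_prodMap]
  simp

lemma fderivWithin_prodMap_id {f : E → E} {f' : E →L[ℝ] E} {S : Set E} {y : E}
    (hf : HasFDerivWithinAt f f' S y) (hS : UniqueDiffWithinAt ℝ S y) (t : ℝ) (w : ℝ × E) :
    fderivWithin ℝ (Prod.map id f) ((univ : Set ℝ) ×ˢ S) (t, y) w = (w.1, f' w.2) := by
  have h1 : HasFDerivWithinAt (fun z : ℝ × E => z.1) (ContinuousLinearMap.fst ℝ ℝ E)
      ((univ : Set ℝ) ×ˢ S) (t, y) := hasFDerivWithinAt_fst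
  have h2 : HasFDerivWithinAt (fun z : ℝ × E => z.2) (ContinuousLinearMap.snd ℝ ℝ E)
      ((univ : Set ℝ) ×ˢ S) (t, y) := hasFDerivWithinAt_snd
  have h3 := h1.prodMk (HasFDerivWithinAt.comp (t, y) (g := f) hf h2 fun z hz => hz.2)
  have h4 : UniqueDiffWithinAt ℝ ((univ : Set ℝ) ×ˢ S) (t, y) := uniqueDiffWithinAt_univ.prod hS
  have h5 := h3.fderivWithin h4
  have e : Prod.map id f = fun z : ℝ × E => (z.1, (f ∘ fun z : ℝ × E => z.2) z) := rfl
  rw [e, h5]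
  rfl

/-- All charts of `ℝ` are the identity, so a change of product charts acts on the `M` factor alone.
-/
lemma tangentCoordChange_real_prod {p q z : ℝ × M}
    (h : z.2 ∈ (extChartAt I p.2).source ∩ (extChartAt I q.2).source) (w : ℝ × E) :
    tangentCoordChange ((𝓘(ℝ, ℝ)).prod I) p q z w =
      (w.1, tangentCoordChange I p.2 q.2 z.2 w.2) := by
  rw [tangentCoordChange_def]
  have e : (extChartAt ((𝓘(ℝ, ℝ)).prod I) q ∘ (extChartAt ((𝓘(ℝ, ℝ)).prod I) p).symm) =
      Prod.map id (extChartAt I q.2 ∘ (extChartAt I p.2).symm) := by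
    funext y
    rw [Function.comp_apply, extChartAt_real_prod_symm_apply, extChartAt_real_prod_apply]
    rfl
  rw [e, extChartAt_real_prod_apply, range_real_prod]
  exact fderivWithin_prodMap_id (hasFDerivWithinAt_tangentCoordChange (I := I) h)
    I.uniqueDiffWithinAt_image _ _

/-- The projection to `TM` of a tangent vector of `ℝ × M`. -/
def spaceLift (v : TangentBundle ((𝓘(ℝ, ℝ)).prod I) (ℝ × M)) : TangentBundle I M :=
  ⟨v.proj.2, (v.2 : ℝ × E).2⟩

lemma components_real_prod {p : ℝ × M} {v : TangentBundle ((𝓘(ℝ, ℝ)).prod I) (ℝ × M)}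
    (hv : v.proj.2 ∈ (chartAt H p.2).source) :
    components ((𝓘(ℝ, ℝ)).prod I) p v = ((v.2 : ℝ × E).1, components I p.2 (spaceLift v)) :=
  tangentCoordChange_real_prod (I := I)
    ⟨mem_extChartAt_source v.proj.2, by rwa [extChartAt_source]⟩ v.2

lemma coordVec_real_prod {p x : ℝ × M} (hx : x.2 ∈ (chartAt H p.2).source) (w : ℝ × E) :
    (coordVec ((𝓘(ℝ, ℝ)).prod I) p x w : ℝ × E) = (w.1, coordVec I p.2 x.2 w.2) := by
  have hx' : x ∈ (chartAt (ModelProd ℝ H) p).source := by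
    simpa [chartAt_self_eq] using hx
  refine (coordVec_eq_tangentCoordChange hx' w).trans ?_
  refine (tangentCoordChange_real_prod (I := I)
    ⟨by rwa [extChartAt_source], mem_extChartAt_source x.2⟩ w).trans ?_
  rw [coordVec_eq_tangentCoordChange hx]
  rfl

lemma isVelocityLift_real_prod_iff {a b : ℝ}
    {γ : ℝ → TangentBundle ((𝓘(ℝ, ℝ)).prod I) (ℝ × M)} :
    IsVelocityLift ((𝓘(ℝ, ℝ)).prod I) a b γ ↔
      (∀ s ∈ Icc a b,
        HasDerivWithinAt (fun r => (γ r).proj.1) ((γ s).2 : ℝ × E).1 (Icc a b) s) ∧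
      IsVelocityLift I a b (fun r => spaceLift (γ r)) := by
  have key : ∀ s, HasMFDerivWithinAt 𝓘(ℝ, ℝ) ((𝓘(ℝ, ℝ)).prod I) (fun r => (γ r).proj) (Icc a b) s
      ((1 : ℝ →L[ℝ] ℝ).smulRight (γ s).2) ↔
      HasDerivWithinAt (fun r => (γ r).proj.1) ((γ s).2 : ℝ × E).1 (Icc a b) s ∧
      HasMFDerivWithinAt 𝓘(ℝ, ℝ) I (fun r => (spaceLift (γ r)).proj) (Icc a b) s
      ((1 : ℝ →L[ℝ] ℝ).smulRight (spaceLift (γ s)).2) := by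
    intro s
    rw [hasMFDerivWithinAt_smulRight_iff, hasMFDerivWithinAt_smulRight_iff]
    simp only [extChartAt_real_prod_apply]
    constructor
    · rintro ⟨h1, h2⟩
      have h3 := (ContinuousLinearMap.fst ℝ ℝ E).hasFDerivAt.comp_hasDerivWithinAt s h2
      have h4 := (ContinuousLinearMap.snd ℝ ℝ E).hasFDerivAt.comp_hasDerivWithinAt s h2
      exact ⟨h3, continuous_snd.continuousAt.comp_continuousWithinAt h1, h4⟩
    · rintro ⟨h1, h2, h3⟩
      exact ⟨h1.continuousWithinAt.prodMk h2, h1.prodMk h3⟩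
  exact ⟨fun h => ⟨fun s hs => ((key s).1 (h s hs)).1, fun s hs => ((key s).1 (h s hs)).2⟩,
    fun h s hs => (key s).2 ⟨h.1 s hs, h.2 s hs⟩⟩

end Product

/-! ### Time and space components; differentiability of the Riemannian metric in charts. -/

section Lorentz

open Filter Topology

set_option linter.unusedSectionVars false

variable {n : ℕ} [NeZero n] {M : Type*} [TopologicalSpace M]
  [ChartedSpace (EuclideanHalfSpace n) M] [IsManifold (𝓡∂ n) ∞ M]
  (g : Metric n M) (om : SmoothOneForm (𝓡∂ n) (M := M) ℝ)

lemma timePart_eq {z : ℝ × M} (u : TangentSpace (cylModel n) z) :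
    timePart u = (u : ℝ × EuclideanSpace ℝ (Fin n)).1 := by
  unfold timePart
  rw [mfderiv_fst]
  rfl

lemma spacePart_eq {z : ℝ × M} (u : TangentSpace (cylModel n) z) :
    spacePart u = (u : ℝ × EuclideanSpace ℝ (Fin n)).2 := by
  unfold spacePart
  rw [mfderiv_snd]
  rfl

/-- The metric in the coordinates of the chart at `p`. -/
def localMetric (p : M) (y v w : EuclideanSpace ℝ (Fin n)) : ℝ :=
  g.inner ((extChartAt (𝓡∂ n) p).symm y) (coordVec (𝓡∂ n) p ((extChartAt (𝓡∂ n) p).symm y) v)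
    (coordVec (𝓡∂ n) p ((extChartAt (𝓡∂ n) p).symm y) w)

/-- In the trivialization at `p` this vector field is constant near `p`. Order `1` suffices, since
Christoffel symbols only need first derivatives. -/
lemma contMDiffAt_coordVec (p : M) (w : EuclideanSpace ℝ (Fin n)) :
    ContMDiffAt (𝓡∂ n) ((𝓡∂ n).prod 𝓘(ℝ, EuclideanSpace ℝ (Fin n))) 1
      (fun x => TotalSpace.mk' (EuclideanSpace ℝ (Fin n)) (E := (TangentSpace (𝓡∂ n) : M → Type _))
        x (coordVec (𝓡∂ n) p x w)) p := by
  rw [contMDiffAt_section]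
  refine (contMDiffAt_const (c := w)).congr_of_eventuallyEq ?_
  filter_upwards [(trivializationAt (EuclideanSpace ℝ (Fin n)) (TangentSpace (𝓡∂ n) : M → Type _)
    p).open_baseSet.mem_nhds (FiberBundle.mem_baseSet_trivializationAt' p)] with x hx
  have := Trivialization.continuousLinearMapAt_symmL (R := ℝ)
    (trivializationAt (EuclideanSpace ℝ (Fin n)) (TangentSpace (𝓡∂ n) : M → Type _) p) hx w
  rw [Trivialization.continuousLinearMapAt_apply, Trivialization.linearMapAt_apply,
    if_pos hx] at this
  exact this

lemma differentiableWithinAt_localMetric (p : M) (v w : EuclideanSpace ℝ (Fin n)) :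
    DifferentiableWithinAt ℝ (fun y => localMetric g p y v w) (range (𝓡∂ n))
      (extChartAt (𝓡∂ n) p p) := by
  have h0 := (g.contMDiff p).of_le (m := 1) (by simp)
  have h := h0.clm_bundle_apply₂ (E₃ := Bundle.Trivial M ℝ) (contMDiffAt_coordVec p v)
    (contMDiffAt_coordVec p w)
  have h2 := (contMDiffAt_section _).1 h
  exact differentiableWithinAt_comp_extChartAt_symm (h2.mdifferentiableAt (by simp))

end Lorentz

/-! ### Christoffel symbols of the Lorentzian metric. -/

section LorentzChristoffel

open Filter Topology

variable {n : ℕ} [NeZero n] {M : Type*} [TopologicalSpace M]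
  [ChartedSpace (EuclideanHalfSpace n) M] [IsManifold (𝓡∂ n) ∞ M]
  (g : Metric n M) (om : SmoothOneForm (𝓡∂ n) (M := M) ℝ)

lemma dtAddOmega_eq (z : ℝ × M) (u : ℝ × EuclideanSpace ℝ (Fin n)) :
    dtAddOmega om z u = u.1 + om.toForm z.2 u.2 :=
  congrArg₂ (fun a b => a + om.toForm z.2 b) (timePart_eq _) (spacePart_eq _)

lemma lorentzMetric_eq (z : ℝ × M) (u w : ℝ × EuclideanSpace ℝ (Fin n)) :
    lorentzMetric g om z u w =
      -((u.1 + om.toForm z.2 u.2) * (w.1 + om.toForm z.2 w.2)) + g.inner z.2 u.2 w.2 := by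
  have h₁ : dtAddOmega om z u * dtAddOmega om z w =
    (u.1 + om.toForm z.2 u.2) * (w.1 + om.toForm z.2 w.2) :=
      congrArg₂ (· * ·) (dtAddOmega_eq om z u) (dtAddOmega_eq om z w)
  exact congrArg₂ (fun a b => -a + b) h₁
    (congrArg₂ (fun a b => g.inner z.2 a b) (spacePart_eq _) (spacePart_eq _))

/-- The Lorentzian metric in product coordinates. -/
lemma lorentzMetric_coordVec (p : ℝ × M) {y : ℝ × EuclideanSpace ℝ (Fin n)}
    (hy : y.2 ∈ (extChartAt (𝓡∂ n) p.2).target) (v w : ℝ × EuclideanSpace ℝ (Fin n)) :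
    lorentzMetric g om ((extChartAt (cylModel n) p).symm y)
      (coordVec (cylModel n) p ((extChartAt (cylModel n) p).symm y) v)
      (coordVec (cylModel n) p ((extChartAt (cylModel n) p).symm y) w) =
    -((v.1 + localForm om.toForm p.2 y.2 v.2) * (w.1 + localForm om.toForm p.2 y.2 w.2)) +
      localMetric g p.2 y.2 v.2 w.2 := by
  have hx : ((y.1, (extChartAt (𝓡∂ n) p.2).symm y.2) : ℝ × M).2 ∈
      (chartAt (EuclideanHalfSpace n) p.2).source := by
    rw [← extChartAt_source (𝓡∂ n)]
    exact (extChartAt (𝓡∂ n) p.2).map_target hy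
  rw [extChartAt_real_prod_symm_apply]
  have e := fun u => coordVec_real_prod (I := 𝓡∂ n) hx u
  refine (lorentzMetric_eq g om _ _ _).trans ?_
  rw [e v, e w]
  rfl

/-- The coordinate expression does not involve `t`, so only the space part of the direction `u`
contributes. The rest is the product rule for `(dt + ω) ⊗ (dt + ω)`. -/
lemma dMetric_lorentzMetric (p : ℝ × M) (u v w : ℝ × EuclideanSpace ℝ (Fin n)) :
    dMetric (cylModel n) (lorentzMetric g om) p u v w =
      -(formDeriv om.toForm p.2 u.2 v.2 * (w.1 + om.toForm p.2 w.2) +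
        (v.1 + om.toForm p.2 v.2) * formDeriv om.toForm p.2 u.2 w.2) +
      dMetric (𝓡∂ n) (metricFun g) p.2 u.2 v.2 w.2 := by
  set y₀ : EuclideanSpace ℝ (Fin n) := extChartAt (𝓡∂ n) p.2 p.2 with hy₀
  have hsnd : HasFDerivWithinAt (fun z : ℝ × EuclideanSpace ℝ (Fin n) => z.2)
      (ContinuousLinearMap.snd ℝ ℝ (EuclideanSpace ℝ (Fin n)))
      ((univ : Set ℝ) ×ˢ range (𝓡∂ n)) (p.1, y₀) := hasFDerivWithinAt_snd
  have hform : ∀ c : ℝ, ∀ v : EuclideanSpace ℝ (Fin n),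
      HasFDerivWithinAt (fun z : ℝ × EuclideanSpace ℝ (Fin n) =>
        c + localForm om.toForm p.2 z.2 v)
      ((fderivWithin ℝ (fun y => localForm om.toForm p.2 y v) (range (𝓡∂ n)) y₀).comp
        (ContinuousLinearMap.snd ℝ ℝ (EuclideanSpace ℝ (Fin n))))
      ((univ : Set ℝ) ×ˢ range (𝓡∂ n)) (p.1, y₀) := by
    intro c v
    have h := (om.differentiableWithinAt_localForm p.2).hasFDerivWithinAt.clm_apply
      (hasFDerivWithinAt_const v y₀ (range (𝓡∂ n)))
    have h' := h.differentiableWithinAt.hasFDerivWithinAt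
    exact (HasFDerivWithinAt.comp (p.1, y₀) h' hsnd fun z hz => hz.2).const_add c
  have hmet := HasFDerivWithinAt.comp (p.1, y₀)
    (differentiableWithinAt_localMetric g p.2 v.2 w.2).hasFDerivWithinAt hsnd fun z hz => hz.2
  have h := ((hform v.1 v.2).mul (hform w.1 w.2)).neg.add hmet
  have huniq : UniqueDiffWithinAt ℝ ((univ : Set ℝ) ×ˢ range (𝓡∂ n)) (p.1, y₀) :=
    uniqueDiffWithinAt_univ.prod (𝓡∂ n).uniqueDiffWithinAt_image
  -- The coordinate formula holds only over the chart target, which is a neighbourhood of the base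
  -- point within the range of the model; that is enough for `fderivWithin`.
  have htarget : ∀ᶠ z in 𝓝[(univ : Set ℝ) ×ˢ range (𝓡∂ n)] (p.1, y₀),
      z.2 ∈ (extChartAt (𝓡∂ n) p.2).target :=
    (hsnd.continuousWithinAt.tendsto_nhdsWithin fun z hz => hz.2)
      (extChartAt_target_mem_nhdsWithin (I := 𝓡∂ n) p.2)
  have h' := h.congr_of_eventuallyEq
    (htarget.mono fun z hz => lorentzMetric_coordVec g om p hz v w)
    (lorentzMetric_coordVec g om p (mem_extChartAt_target p.2) v w)
  generalize hD : dMetric (𝓡∂ n) (metricFun g) p.2 u.2 v.2 w.2 = D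
  unfold dMetric
  rw [range_real_prod, extChartAt_real_prod_apply]
  refine (congrArg (fun L => L u) (h'.fderivWithin huniq)).trans ?_
  change -((v.1 + localForm om.toForm p.2 y₀ v.2) * formDeriv om.toForm p.2 u.2 w.2 +
    (w.1 + localForm om.toForm p.2 y₀ w.2) * formDeriv om.toForm p.2 u.2 v.2) +
    dMetric (𝓡∂ n) (metricFun g) p.2 u.2 v.2 w.2 = _
  have e₁ : localForm om.toForm p.2 y₀ v.2 = om.toForm p.2 v.2 := localForm_self om.toForm p.2 v.2
  have e₂ : localForm om.toForm p.2 y₀ w.2 = om.toForm p.2 w.2 := localForm_self om.toForm p.2 w.2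
  rw [e₁, e₂, hD]
  ring

/-- With `u` in both first slots, the derivatives of `ω` multiplying `(dt + ω)(u)` antisymmetrise to
`dω(u, w)`. This term is the source of the magnetic force. -/
lemma christoffel_lorentzMetric (p : ℝ × M) (u w : ℝ × EuclideanSpace ℝ (Fin n)) :
    christoffel (cylModel n) (lorentzMetric g om) p u u w =
      -(formDeriv om.toForm p.2 u.2 u.2 * (w.1 + om.toForm p.2 w.2)) -
        (u.1 + om.toForm p.2 u.2) * dForm (𝓡∂ n) (fun x v => om.toForm x v) p.2 u.2 w.2 +
      christoffel (𝓡∂ n) (metricFun g) p.2 u.2 u.2 w.2 := by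
  have hd : dForm (𝓡∂ n) (fun x v => om.toForm x v) p.2 u.2 w.2 =
    formDeriv om.toForm p.2 u.2 w.2 - formDeriv om.toForm p.2 w.2 u.2 := rfl
  rw [hd]
  unfold christoffel
  rw [dMetric_lorentzMetric, dMetric_lorentzMetric]
  ring

end LorentzChristoffel

/-! ### Null geodesics of `ℝ × M` and magnetic geodesics of `M`. -/

section NullGeodesics

open Filter Topology

variable {n : ℕ} [NeZero n] {M : Type*} [TopologicalSpace M]
  [ChartedSpace (EuclideanHalfSpace n) M] [IsManifold (𝓡∂ n) ∞ M]
  (g : Metric n M) (om : SmoothOneForm (𝓡∂ n) (M := M) ℝ)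

/-- The lowered acceleration for the Lorentzian metric, split into its parts along and transversal
to `dt + ω`. -/
lemma lorentzMetric_add_christoffel (p : ℝ × M) (acc u w : ℝ × EuclideanSpace ℝ (Fin n)) :
    lorentzMetric g om p acc w + christoffel (cylModel n) (lorentzMetric g om) p u u w =
      -((acc.1 + (formDeriv om.toForm p.2 u.2 u.2 + om.toForm p.2 acc.2)) *
        (w.1 + om.toForm p.2 w.2)) +
      (g.inner p.2 acc.2 w.2 + christoffel (𝓡∂ n) (metricFun g) p.2 u.2 u.2 w.2 -
        (u.1 + om.toForm p.2 u.2) *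
          dForm (𝓡∂ n) (fun x v => om.toForm x v) p.2 u.2 w.2) := by
  refine (congrArg₂ (· + ·) (lorentzMetric_eq g om p acc w)
    (christoffel_lorentzMetric g om p u w)).trans ?_
  ring

lemma hasDerivWithinAt_components_cyl_iff {a b : ℝ}
    {γ : ℝ → TangentBundle (cylModel n) (ℝ × M)} (h : IsVelocityLift (cylModel n) a b γ) {s : ℝ}
    (hs : s ∈ Icc a b) (acc : ℝ × EuclideanSpace ℝ (Fin n)) :
    HasDerivWithinAt (fun r => components (cylModel n) (γ s).proj (γ r)) acc (Icc a b) s ↔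
      HasDerivWithinAt (fun r => ((γ r).2 : ℝ × EuclideanSpace ℝ (Fin n)).1) acc.1 (Icc a b) s ∧
      HasDerivWithinAt (fun r => components (𝓡∂ n) (spaceLift (γ s)).proj (spaceLift (γ r))) acc.2
        (Icc a b) s := by
  have hsp := (isVelocityLift_real_prod_iff.1 h).2
  have e : (fun r => components (cylModel n) (γ s).proj (γ r)) =ᶠ[𝓝[Icc a b] s]
      fun r => (((γ r).2 : ℝ × EuclideanSpace ℝ (Fin n)).1,
        components (𝓡∂ n) (spaceLift (γ s)).proj (spaceLift (γ r))) := by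
    filter_upwards [hsp.eventually_mem_source hs] with r hr
    exact components_real_prod (p := (γ s).proj) hr
  rw [e.hasDerivWithinAt_iff_of_mem hs]
  constructor
  · intro h
    have h1 := (ContinuousLinearMap.fst ℝ ℝ
      (EuclideanSpace ℝ (Fin n))).hasFDerivAt.comp_hasDerivWithinAt s h
    have h2 := (ContinuousLinearMap.snd ℝ ℝ
      (EuclideanSpace ℝ (Fin n))).hasFDerivAt.comp_hasDerivWithinAt s h
    exact ⟨h1, h2⟩
  · rintro ⟨h1, h2⟩
    exact h1.prodMk h2

variable {g om}

/-- The product of the velocity of a geodesic with `∂_t` is conserved, and the projection of the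
geodesic satisfies a Lorentz force equation. -/
lemma IsGeodesic.hasDerivWithinAt_dtAddOmega {a b : ℝ}
    {γ : ℝ → TangentBundle (cylModel n) (ℝ × M)}
    (h : IsGeodesic (cylModel n) (lorentzMetric g om) a b γ) {s : ℝ} (hs : s ∈ Icc a b) :
    HasDerivWithinAt (fun r => dtAddOmega om (γ r).proj (γ r).2) 0 (Icc a b) s ∧
    HasLoweredAcceleration (𝓡∂ n) (metricFun g) a b (fun r => spaceLift (γ r)) s
      (fun w => dtAddOmega om (γ s).proj (γ s).2 *
        dForm (𝓡∂ n) (fun x v => om.toForm x v) (γ s).proj.2 (spaceLift (γ s)).2 w) := by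
  obtain ⟨hv, hacc⟩ := h
  have hsp := (isVelocityLift_real_prod_iff.1 hv).2
  obtain ⟨acc, h1, h2⟩ := hacc s hs
  obtain ⟨h3, h4⟩ := (hasDerivWithinAt_components_cyl_iff hv hs acc).1 h1
  have h5 := h3.add (om.hasDerivWithinAt_velocity hsp hs h4)
  set u : ℝ × EuclideanSpace ℝ (Fin n) := (γ s).2 with hu
  have key : ∀ w : ℝ × EuclideanSpace ℝ (Fin n), _ := fun w =>
    (lorentzMetric_add_christoffel g om (γ s).proj acc u w).symm.trans (h2 w)
  -- Subtracting the equations tested on `∂_t` and on `0` isolates the coefficient of `dt + ω`; the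
  -- terms in the zero space vector cancel without being evaluated.
  have hX : ((acc : ℝ × EuclideanSpace ℝ (Fin n)).1 + (formDeriv om.toForm (γ s).proj.2 u.2 u.2 +
      om.toForm (γ s).proj.2 (acc : ℝ × EuclideanSpace ℝ (Fin n)).2)) = 0 := by
    have k1 := key (1, 0)
    have k0 := key (0, 0)
    simp only at k1 k0
    linear_combination k0 - k1
  constructor
  · refine (h5.congr_deriv hX).congr (fun r _ => ?_) ?_
    · exact dtAddOmega_eq om (γ r).proj (γ r).2
    · exact dtAddOmega_eq om (γ s).proj (γ s).2
  · refine ⟨_, h4, fun w => ?_⟩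
    have k := key (0, w)
    rw [hX] at k
    have e : dtAddOmega om (γ s).proj (γ s).2 = u.1 + om.toForm (γ s).proj.2 u.2 :=
      dtAddOmega_eq om (γ s).proj (γ s).2
    rw [e]
    simp only [zero_mul, neg_zero, zero_add] at k
    exact sub_eq_zero.1 k

/-- A null geodesic whose product with `-∂_t` is `1` projects to a magnetic geodesic. -/
lemma IsNullGeodesic.isMagneticGeodesic {a b : ℝ} {γ : ℝ → TangentBundle (cylModel n) (ℝ × M)}
    (h : IsNullGeodesic g om a b γ) {s₀ : ℝ} (hs₀ : s₀ ∈ Icc a b)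
    (h₀ : dtAddOmega om (γ s₀).proj (γ s₀).2 = 1) :
    IsMagneticGeodesic g om a b (fun r => spaceLift (γ r)) := by
  obtain ⟨hg, hn⟩ := h
  have hconst : ∀ s ∈ Icc a b, dtAddOmega om (γ s).proj (γ s).2 = 1 := by
    intro s hs
    rw [← h₀]
    have hd := (convex_Icc a b).norm_image_sub_le_of_norm_hasDerivWithin_le (C := 0)
      (fun r hr => (hg.hasDerivWithinAt_dtAddOmega hr).1) (by simp) hs₀ hs
    simpa [sub_eq_zero] using hd
  refine ⟨(isVelocityLift_real_prod_iff.1 hg.1).2, fun s hs => ?_, fun s hs => ?_⟩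
  · have h1 := (hn s hs).1
    unfold lorentzMetric at h1
    rw [hconst s hs, spacePart_eq] at h1
    have h2 : g.inner (spaceLift (γ s)).proj (spaceLift (γ s)).2 (spaceLift (γ s)).2 = -(-(1 * 1)) :=
      (neg_eq_of_add_eq_zero_right h1).symm
    rw [h2]
    norm_num
  · obtain ⟨acc, h1, h2⟩ := (hg.hasDerivWithinAt_dtAddOmega hs).2
    exact ⟨acc, h1, fun w =>
      (h2 w).trans ((congrArg (· * _) (hconst s hs)).trans (one_mul _))⟩

/-- The lift of a curve in `TM` to `T(ℝ × M)` with `dt + ω = 1` and time coordinate `τ`. -/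
def nullLift (om : SmoothOneForm (𝓡∂ n) (M := M) ℝ) (τ : ℝ → ℝ)
    (γ : ℝ → TangentBundle (𝓡∂ n) M) (s : ℝ) : TangentBundle (cylModel n) (ℝ × M) :=
  ⟨(τ s, (γ s).proj), ((1 - om.toForm (γ s).proj (γ s).2, (γ s).2) :
    ℝ × EuclideanSpace ℝ (Fin n))⟩

lemma dtAddOmega_nullLift (τ : ℝ → ℝ) (γ : ℝ → TangentBundle (𝓡∂ n) M) (s : ℝ) :
    dtAddOmega om (nullLift om τ γ s).proj (nullLift om τ γ s).2 = 1 :=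
  (dtAddOmega_eq om _ _).trans (sub_add_cancel _ _)

/-- The time component `1 - ω(ẋ)` keeps `dt + ω` equal to `1`. The part of the geodesic equation
along `dt + ω` then vanishes, and the transversal part is the Lorentz force equation. -/
lemma IsMagneticGeodesic.isNullGeodesic {a b : ℝ} {γ : ℝ → TangentBundle (𝓡∂ n) M}
    (h : IsMagneticGeodesic g om a b γ) {τ : ℝ → ℝ}
    (hτ : ∀ s ∈ Icc a b, HasDerivWithinAt τ (1 - om.toForm (γ s).proj (γ s).2) (Icc a b) s) :
    IsNullGeodesic g om a b (nullLift om τ γ) := by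
  obtain ⟨hv, hunit, hacc⟩ := h
  have hlift : IsVelocityLift (cylModel n) a b (nullLift om τ γ) :=
    isVelocityLift_real_prod_iff.2 ⟨hτ, hv⟩
  refine ⟨⟨hlift, fun s hs => ?_⟩, fun s hs => ⟨?_, ?_⟩⟩
  · obtain ⟨acc, h1, h2⟩ := hacc s hs
    have h3 := om.hasDerivWithinAt_velocity hv hs h1
    refine ⟨(-(formDeriv om.toForm (γ s).proj (γ s).2 (γ s).2 + om.toForm (γ s).proj acc), acc),
      (hasDerivWithinAt_components_cyl_iff hlift hs _).2 ⟨h3.const_sub 1, h1⟩, fun w => ?_⟩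
    refine (lorentzMetric_add_christoffel g om _ _ _ _).trans ?_
    have h4 := h2 (w : ℝ × EuclideanSpace ℝ (Fin n)).2
    -- Here `X` is the derivative of `ω(ẋ)`, `D` is `ω(ẋ)`, `C` is the force, and `A + B` is the
    -- lowered acceleration in `M`.
    have e : ∀ X Y A B C D : ℝ, A + B = C → -((-X + X) * Y) + (A + B - (1 - D + D) * C) = 0 := by
      intro X Y A B C D h
      rw [h]
      ring
    exact e _ _ _ _ _ _ h4
  · unfold lorentzMetric
    rw [dtAddOmega_nullLift, spacePart_eq]
    have h1 : g.inner (nullLift om τ γ s).proj.2 (γ s).2 (γ s).2 = 1 := hunit s hs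
    refine (congrArg (fun x => -(1 * 1) + x) h1).trans ?_
    norm_num
  · rw [dtAddOmega_nullLift]
    exact one_pos

end NullGeodesics

/-! ### Inward and glancing geodesics at the boundary. -/

section Boundary

open Filter Topology

set_option linter.unusedSectionVars false

variable {n : ℕ} [NeZero n] {M : Type*} [TopologicalSpace M]
  [ChartedSpace (EuclideanHalfSpace n) M] [IsManifold (𝓡∂ n) ∞ M]
  {g : Metric n M} {om : SmoothOneForm (𝓡∂ n) (M := M) ℝ}

/-- The inward unit normal exists and is dual to a positive multiple of the normal component. -/
lemma exists_isInwardUnitNormal (g : Metric n M) (p : M) :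
    ∃ (ν : TangentSpace (𝓡∂ n) p) (c : ℝ), IsInwardUnitNormal g p ν ∧ 0 < c ∧
      ∀ w : TangentSpace (𝓡∂ n) p, g.inner p ν w = c * normalComponent w := by
  let B : EuclideanSpace ℝ (Fin n) →L[ℝ] EuclideanSpace ℝ (Fin n) →L[ℝ] ℝ := g.inner p
  have hpos : ∀ v, v ≠ 0 → 0 < B v v := g.pos p
  let L : EuclideanSpace ℝ (Fin n) →ₗ[ℝ] Module.Dual ℝ (EuclideanSpace ℝ (Fin n)) :=
    (ContinuousLinearMap.coeLM ℝ).comp B.toLinearMap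
  have hL : ∀ v w, L v w = B v w := fun _ _ => rfl
  have hinj : Function.Injective L := by
    rw [injective_iff_map_eq_zero]
    intro v hv
    by_contra hne
    have := hpos v hne
    rw [← hL, hv] at this
    simp at this
  have hsurj : Function.Surjective L :=
    (LinearMap.injective_iff_surjective_of_finrank_eq_finrank
      Subspace.dual_finrank_eq.symm).1 hinj
  -- `ν₀` is the `g`-gradient of the boundary-defining coordinate.
  obtain ⟨ν₀, hν₀⟩ := hsurj (EuclideanSpace.proj (0 : Fin n) :
    EuclideanSpace ℝ (Fin n) →L[ℝ] ℝ).toLinearMap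
  have h0 : ∀ w, B ν₀ w = w 0 := fun w => by
    rw [← hL, hν₀]
    rfl
  have hne : ν₀ ≠ 0 := by
    rintro rfl
    have := h0 (EuclideanSpace.single 0 1)
    simp at this
  have hd : 0 < ν₀ 0 := by
    rw [← h0]
    exact hpos _ hne
  -- Since `g(ν₀, ν₀) = ν₀ 0`, this factor normalises `ν₀` to unit length.
  set c : ℝ := (Real.sqrt (ν₀ 0))⁻¹ with hc
  have hcpos : 0 < c := inv_pos.2 (Real.sqrt_pos.2 hd)
  have hcc : c * c * ν₀ 0 = 1 := by
    rw [hc, ← mul_inv, Real.mul_self_sqrt hd.le, inv_mul_cancel₀ hd.ne']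
  have hB : ∀ w, B (c • ν₀) w = c * w 0 := fun w => by
    rw [map_smul]
    change c • B ν₀ w = _
    rw [h0, smul_eq_mul]
  refine ⟨(c • ν₀ : EuclideanSpace ℝ (Fin n)), c, ⟨?_, ?_, fun w hw => ?_⟩, hcpos, hB⟩
  · refine (hB (c • ν₀)).trans ?_
    rw [PiLp.smul_apply, smul_eq_mul, ← mul_assoc, hcc]
  · change 0 < c * ν₀ 0
    positivity
  · exact (hB w).trans ((congrArg (c * ·) hw).trans (mul_zero c))

lemma extChartAt_zero_nonneg (p x : M) :
    0 ≤ (extChartAt (𝓡∂ n) p x : EuclideanSpace ℝ (Fin n)) 0 := by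
  have h : extChartAt (𝓡∂ n) p x ∈ range (𝓡∂ n) :=
    mem_range_self (f := 𝓡∂ n) (chartAt (EuclideanHalfSpace n) p x)
  rwa [range_modelWithCornersEuclideanHalfSpace] at h

lemma extChartAt_zero_eq_zero {p : M} (hp : p ∈ (𝓡∂ n).boundary M) :
    (extChartAt (𝓡∂ n) p p : EuclideanSpace ℝ (Fin n)) 0 = 0 := by
  have h : extChartAt (𝓡∂ n) p p ∈ frontier (range (𝓡∂ n)) := hp
  rw [frontier_range_modelWithCornersEuclideanHalfSpace] at h
  exact h.symm

lemma hasDerivWithinAt_coord {c : ℝ → EuclideanSpace ℝ (Fin n)} {c' : EuclideanSpace ℝ (Fin n)}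
    {S : Set ℝ} {s : ℝ} (h : HasDerivWithinAt c c' S s) (i : Fin n) :
    HasDerivWithinAt (fun r => c r i) (c' i) S s := by
  have := (EuclideanSpace.proj i : EuclideanSpace ℝ (Fin n) →L[ℝ] ℝ).hasFDerivAt
    |>.comp_hasDerivWithinAt s h
  exact this

/-- A curve with inward initial velocity at the boundary cannot be continued backwards. -/
lemma IsVelocityLift.eq_zero_of_normalComponent_pos {σ κ : ℝ} {γ : ℝ → TangentBundle (𝓡∂ n) M}
    (h : IsVelocityLift (𝓡∂ n) σ κ γ) (hσ : σ ≤ 0) (hκ : 0 ≤ κ)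
    (hb : (γ 0).proj ∈ (𝓡∂ n).boundary M) (hv : 0 < normalComponent (γ 0).2) : σ = 0 := by
  have h1 := hasDerivWithinAt_coord
    (h.hasDerivWithinAt_extChartAt ⟨hσ, hκ⟩ (mem_chart_source _ _)) 0
  rw [components_self] at h1
  -- The boundary coordinate is nonnegative and vanishes at time `0`, so its derivative in the
  -- admissible direction `σ ≤ 0` is nonnegative, although its velocity is positive.
  have hmin : IsLocalMinOn (fun r => (extChartAt (𝓡∂ n) (γ 0).proj (γ r).proj) 0) (Icc σ κ) 0 := by
    refine Eventually.of_forall fun r => ?_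
    change (extChartAt (𝓡∂ n) (γ 0).proj (γ 0).proj) 0 ≤ _
    rw [extChartAt_zero_eq_zero hb]
    exact extChartAt_zero_nonneg _ _
  have h2 := hmin.hasFDerivWithinAt_nonneg h1.hasFDerivWithinAt
    (y := σ - 0) (sub_mem_posTangentConeAt_of_segment_subset
      ((convex_Icc σ κ).segment_subset ⟨hσ, hκ⟩ ⟨le_rfl, hσ.trans hκ⟩))
  have h3 : 0 ≤ (σ - 0) * normalComponent (γ 0).2 := by
    simpa using! h2
  nlinarith

/-- A glancing magnetic geodesic leaves a strictly magnetic convex manifold at once. -/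
lemma IsMagneticGeodesic.eq_zero_of_normalComponent_eq_zero
    (hconv : StrictlyMagneticConvex g om) {σ κ : ℝ} {γ : ℝ → TangentBundle (𝓡∂ n) M}
    (h : IsMagneticGeodesic g om σ κ γ) (hσ : σ ≤ 0) (hκ : 0 ≤ κ)
    (hb : (γ 0).proj ∈ (𝓡∂ n).boundary M) (hv : normalComponent (γ 0).2 = 0) : κ = 0 := by
  by_contra hne
  have hκ' : 0 < κ := lt_of_le_of_ne hκ (Ne.symm hne)
  have h0 : (0 : ℝ) ∈ Icc σ κ := ⟨hσ, hκ⟩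
  obtain ⟨hvel, hunit, hacc⟩ := h
  obtain ⟨acc, h1, h2⟩ := hacc 0 h0
  -- The equation of motion tested on `ν` gives `g(acc, ν) = dω(v, ν) - Γ(v, v; ν)`, which strict
  -- convexity makes negative; `g(acc, ν)` is a positive multiple of `acc 0`.
  have hacc0 : acc 0 < 0 := by
    obtain ⟨ν, c, hν, hc, hνc⟩ := exists_isInwardUnitNormal g (γ 0).proj
    have h3 := hconv _ hb ν hν (γ 0).2 hv (hunit 0 h0)
    have h4 := h2 ν
    have h5 : metricFun g (γ 0).proj acc ν = c * acc 0 := (g.symm _ _ _).trans (hνc acc)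
    have h6 : metricFun g (γ 0).proj acc ν < 0 := by
      linarith
    rw [h5] at h6
    by_contra hcon
    exact absurd h6 (not_lt.2 (mul_nonneg hc.le (not_lt.1 hcon)))
  set p := (γ 0).proj with hp
  -- In the fixed chart at `p`, `f` is the boundary coordinate of the curve and `c` its derivative.
  -- As `c` starts at zero with negative slope, `f` must decrease from `0`, leaving the half-space.
  set c : ℝ → ℝ := fun r => (components (𝓡∂ n) p (γ r)) 0 with hcdef
  set f : ℝ → ℝ := fun r => (extChartAt (𝓡∂ n) p (γ r).proj) 0 with hf
  have hc0 : c 0 = 0 := by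
    change (components (𝓡∂ n) p (γ 0)) 0 = 0
    rw [hp, components_self]
    exact hv
  have hcd : HasDerivWithinAt c (acc 0) (Ioi 0) 0 :=
    (((hasDerivWithinAt_coord h1 0).mono (Icc_subset_Icc_left hσ)).mono_of_mem_nhdsWithin
      (Icc_mem_nhdsGT hκ'))
  have hslope := (hasDerivWithinAt_iff_tendsto_slope' (by simp)).1 hcd
  have hneg : ∀ᶠ r in 𝓝[>] (0 : ℝ), c r < 0 := by
    filter_upwards [hslope.eventually (gt_mem_nhds hacc0), self_mem_nhdsWithin] with r hr hr0
    rw [slope_def_field, hc0, sub_zero, sub_zero] at hr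
    simpa using (div_lt_iff₀ hr0).1 hr
  have hsrc : ∀ᶠ r in 𝓝[>] (0 : ℝ), (γ r).proj ∈ (chartAt (EuclideanHalfSpace n) p).source := by
    have := hvel.eventually_mem_source h0
    refine this.filter_mono ?_
    exact nhdsWithin_le_of_mem (mem_of_superset (Icc_mem_nhdsGT hκ') (Icc_subset_Icc_left hσ))
  obtain ⟨ε, hε, hεs⟩ := mem_nhdsGT_iff_exists_Ioo_subset.1
    (inter_mem hneg (inter_mem hsrc (Ioo_mem_nhdsGT hκ')))
  have hε0 : 0 < ε := hε
  set δ := ε / 2 with hδ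
  have hδ0 : 0 < δ := by positivity
  have hsub : ∀ r ∈ Ioc 0 δ, c r < 0 ∧ (γ r).proj ∈ (chartAt (EuclideanHalfSpace n) p).source ∧
      r ∈ Ioo 0 κ := fun r hr => hεs ⟨hr.1, by linarith [hr.2]⟩
  have hderiv : ∀ r ∈ Icc 0 δ, HasDerivWithinAt f (c r) (Icc σ κ) r := by
    intro r hr
    rcases eq_or_lt_of_le hr.1 with h | h
    · subst h
      exact hasDerivWithinAt_coord
        (hvel.hasDerivWithinAt_extChartAt h0 (mem_chart_source _ _)) 0
    · have hr' := hsub r ⟨h, hr.2⟩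
      exact hasDerivWithinAt_coord
        (hvel.hasDerivWithinAt_extChartAt ⟨by linarith [hr'.2.2.1], hr'.2.2.2.le⟩ hr'.2.1) 0
  have hδκ : δ < κ := (hsub δ ⟨hδ0, le_rfl⟩).2.2.2
  obtain ⟨r, hr, hre⟩ := exists_hasDerivAt_eq_slope f c hδ0
    (fun r hr => (hderiv r hr).continuousWithinAt.mono (Icc_subset_Icc hσ hδκ.le))
    (fun r hr => (hderiv r ⟨hr.1.le, hr.2.le⟩).hasDerivAt
      (Icc_mem_nhds (by linarith [hr.1]) (by linarith [hr.2])))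
  have hcr := (hsub r ⟨hr.1, hr.2.le⟩).1
  have hf0 : f 0 = 0 := extChartAt_zero_eq_zero hb
  rw [hre, hf0, sub_zero, sub_zero] at hcr
  rw [div_lt_iff₀ hδ0, zero_mul] at hcr
  exact absurd (extChartAt_zero_nonneg p (γ δ).proj) (not_le.2 hcr)

end Boundary

/-! ### Invertibility and continuity of parallel transport. -/

section Transport

open Filter Topology Matrix

variable {N : ℕ}

/-- A crude bound in the sup norm, giving a Lipschitz constant for the transport equation. -/
lemma norm_mulVec_le (A : Mat N) (x : Fin N → ℂ) :
    ‖A *ᵥ x‖ ≤ (∑ i, ∑ j, ‖A i j‖) * ‖x‖ := by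
  have hnn : 0 ≤ ∑ i, ∑ j, ‖A i j‖ :=
    Finset.sum_nonneg fun i _ => Finset.sum_nonneg fun j _ => norm_nonneg _
  refine (pi_norm_le_iff_of_nonneg (mul_nonneg hnn (norm_nonneg x))).2 fun i => ?_
  calc ‖(A *ᵥ x) i‖ ≤ ∑ j, ‖A i j * x j‖ :=
        norm_sum_le Finset.univ fun j => A i j * x j
    _ ≤ ∑ j, ‖A i j‖ * ‖x‖ := Finset.sum_le_sum fun j _ => by
        rw [norm_mul]
        exact mul_le_mul_of_nonneg_left (norm_le_pi_norm x j) (norm_nonneg _)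
    _ = (∑ j, ‖A i j‖) * ‖x‖ := (Finset.sum_mul _ _ _).symm
    _ ≤ _ := mul_le_mul_of_nonneg_right
        (Finset.single_le_sum (f := fun i => ∑ j, ‖A i j‖)
          (fun i _ => Finset.sum_nonneg fun j _ => norm_nonneg _) (Finset.mem_univ i))
        (norm_nonneg x)

/-- If `P s` kills `w ≠ 0`, then `r ↦ P r *ᵥ w` solves a linear equation and vanishes at `s`. By
uniqueness backwards in time it vanishes at `0`, where it equals `w`. -/
lemma IsParallelTransport.det_ne_zero {α P : ℝ → Mat N} {l : ℝ}
    (hα : ∀ i j, ContinuousOn (fun s => α s i j) (Icc 0 l)) (h : IsParallelTransport α l P)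
    {s : ℝ} (hs : s ∈ Icc 0 l) : (P s).det ≠ 0 := by
  intro hdet
  obtain ⟨w, hw, hPw⟩ := Matrix.exists_mulVec_eq_zero_iff.2 hdet
  have hcont : ContinuousOn (fun s => ∑ i, ∑ j, ‖α s i j‖) (Icc 0 l) :=
    continuousOn_finsetSum _ fun i _ => continuousOn_finsetSum _ fun j _ => (hα i j).norm
  obtain ⟨K, hK⟩ := isCompact_Icc.bddAbove_image hcont
  have hderiv : ∀ t ∈ Icc 0 l,
      HasDerivWithinAt (fun r => P r *ᵥ w) (-(α t *ᵥ (P t *ᵥ w))) (Icc 0 l) t := by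
    intro t ht
    rw [hasDerivWithinAt_pi]
    intro i
    have h1 : HasDerivWithinAt (fun r => ∑ j, P r i j * w j) (∑ j, (-(α t * P t) i j) * w j)
        (Icc 0 l) t := HasDerivWithinAt.fun_sum fun j _ => (h.2 t ht i j).mul_const (w j)
    refine h1.congr_deriv ?_
    rw [Matrix.mulVec_mulVec]
    simp [Matrix.mulVec, dotProduct]
  have huniq := ODE_solution_unique_of_mem_Icc_left (a := 0) (b := s) (K := K.toNNReal)
    (v := fun t x => -(α t *ᵥ x)) (s := fun _ => univ) (f := fun r => P r *ᵥ w) (g := fun _ => 0)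
    (fun t ht => by
      refine LipschitzWith.lipschitzOnWith (LipschitzWith.of_dist_le_mul fun x y => ?_)
      have hb : ∑ i, ∑ j, ‖α t i j‖ ≤ K := hK ⟨t, ⟨ht.1.le, ht.2.trans hs.2⟩, rfl⟩
      rw [dist_neg_neg, dist_eq_norm, dist_eq_norm, ← Matrix.mulVec_sub]
      exact (norm_mulVec_le _ _).trans
        (mul_le_mul_of_nonneg_right (hb.trans (Real.le_coe_toNNReal K)) (norm_nonneg _)))
    (fun t ht => ((hderiv t ⟨ht.1, ht.2.trans hs.2⟩).continuousWithinAt.mono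
      (Icc_subset_Icc_right hs.2)))
    (fun t ht => (hderiv t ⟨ht.1.le, ht.2.trans hs.2⟩).mono_of_mem_nhdsWithin
      (mem_of_superset (Icc_mem_nhdsLE ht.1) (Icc_subset_Icc_right (ht.2.trans hs.2))))
    (fun _ _ => mem_univ _) continuousOn_const
    (fun t _ => by simpa using hasDerivWithinAt_const (t : ℝ) (Iic t) (0 : Fin N → ℂ))
    (fun _ _ => mem_univ _) hPw
  have h0 := huniq ⟨le_rfl, hs.1⟩
  simp only [h.1, Matrix.one_mulVec] at h0
  exact hw h0

lemma IsParallelTransport.continuousOn {α P : ℝ → Mat N} {l : ℝ}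
    (h : IsParallelTransport α l P) : ContinuousOn P (Icc 0 l) :=
  continuousOn_pi.2 fun i => continuousOn_pi.2 fun j => fun s hs =>
    (h.2 s hs i j).continuousWithinAt

/-- Cramer's rule: the inverse is the adjugate divided by the nonvanishing determinant. -/
lemma IsParallelTransport.continuousOn_inv {α P : ℝ → Mat N} {l : ℝ}
    (hα : ∀ i j, ContinuousOn (fun s => α s i j) (Icc 0 l)) (h : IsParallelTransport α l P) :
    ContinuousOn (fun s => (P s)⁻¹) (Icc 0 l) := by
  have h1 : ContinuousOn (fun s => (P s).det) (Icc 0 l) :=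
    (continuous_id.matrix_det).comp_continuousOn h.continuousOn
  have h2 : ContinuousOn (fun s => (P s).adjugate) (Icc 0 l) :=
    (continuous_id.matrix_adjugate).comp_continuousOn h.continuousOn
  refine ((h1.inv₀ fun s hs => h.det_ne_zero hα hs).smul h2).congr fun s _ => ?_
  rw [Matrix.inv_def, Ring.inverse_eq_inv']
  rfl

end Transport

/-! ### Compactly supported functions are determined by their moments. -/

section Moments

open MeasureTheory Filter Topology

lemma hasCompactSupport_of_abs {F : Type*} [Zero F] {f : ℝ → F} {R : ℝ}
    (hR : ∀ t, R < |t| → f t = 0) :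
    HasCompactSupport f := by
  refine HasCompactSupport.intro (isCompact_Icc (a := -R) (b := R)) fun t ht => hR t ?_
  by_contra hcon
  exact ht (abs_le.1 (not_lt.1 hcon))

/-- A continuous function vanishing outside a bounded interval all of whose moments vanish is
zero. -/
lemma eq_zero_of_moments_eq_zero_real {f : ℝ → ℝ} (hf : Continuous f) {R : ℝ}
    (hR : ∀ t, R < |t| → f t = 0) (hm : ∀ k : ℕ, ∫ t, t ^ k * f t = 0) : f = 0 := by
  have hcs : HasCompactSupport f := hasCompactSupport_of_abs hR
  have hint : ∀ φ : ℝ → ℝ, Continuous φ → Integrable (fun t => φ t * f t) := fun φ hφ =>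
    (hφ.mul hf).integrable_of_hasCompactSupport hcs.mul_left
  have hpoly : ∀ p : Polynomial ℝ, ∫ t, p.eval t * f t = 0 := by
    intro p
    simp only [Polynomial.eval_eq_sum_range, Finset.sum_mul, mul_assoc]
    rw [integral_finsetSum _ fun i _ => (hint (fun t => t ^ i) (by fun_prop)).const_mul _]
    refine Finset.sum_eq_zero fun i _ => ?_
    rw [integral_const_mul, hm, mul_zero]
  have hfi : Integrable (fun t => |f t|) := (hf.integrable_of_hasCompactSupport hcs).abs
  have hC : 0 ≤ ∫ t, |f t| := integral_nonneg fun t => abs_nonneg _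
  have hsq : ∫ t, f t * f t = 0 := by
    have hnn : 0 ≤ ∫ t, f t * f t := integral_nonneg fun t => mul_self_nonneg _
    refine le_antisymm (le_of_forall_pos_le_add fun ε hε => ?_) hnn
    -- Vanishing moments make `f` orthogonal to `p`, so `∫ f² = ∫ (f - p) f`. The `+ 1` keeps the
    -- denominator positive when `∫ |f|` is zero.
    obtain ⟨p, hp⟩ := exists_polynomial_near_of_continuousOn (-R) R f hf.continuousOn
      (ε / ((∫ t, |f t|) + 1)) (by positivity)
    have e : ∫ t, f t * f t = ∫ t, (f t - p.eval t) * f t := by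
      have : ∀ t, (f t - p.eval t) * f t = f t * f t - p.eval t * f t := fun t => by ring
      simp only [this]
      rw [integral_sub (hint f hf) (hint _ p.continuous), hpoly, sub_zero]
    rw [e, zero_add]
    calc ∫ t, (f t - p.eval t) * f t
        ≤ ∫ t, (ε / ((∫ t, |f t|) + 1)) * |f t| := by
          refine integral_mono (hint _ (hf.sub p.continuous)) (hfi.const_mul _) fun t => ?_
          by_cases ht : R < |t|
          · simp [hR t ht]
          · have h1 := hp t (abs_le.1 (not_lt.1 ht))
            calc (f t - p.eval t) * f t ≤ |(f t - p.eval t) * f t| := le_abs_self _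
              _ = |p.eval t - f t| * |f t| := by rw [abs_mul, abs_sub_comm]
              _ ≤ _ := mul_le_mul_of_nonneg_right h1.le (abs_nonneg _)
      _ = ε * ((∫ t, |f t|) / ((∫ t, |f t|) + 1)) := by
          rw [integral_const_mul]
          ring
      _ ≤ ε * 1 := by
          refine mul_le_mul_of_nonneg_left ?_ hε.le
          rw [div_le_one (by positivity)]
          linarith
      _ = ε := mul_one ε
  have h0 := (integral_eq_zero_iff_of_nonneg (fun t => mul_self_nonneg (f t)) (hint f hf)).1 hsq
  have h1 := (hf.mul hf).ae_eq_iff_eq volume (g := 0) continuous_const |>.1 h0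
  funext t
  exact mul_self_eq_zero.1 (congrFun h1 t)

/-- The weights `t ^ k` are real, so real and imaginary parts separately have vanishing moments. -/
lemma eq_zero_of_moments_eq_zero {f : ℝ → ℂ} (hf : Continuous f) {R : ℝ}
    (hR : ∀ t, R < |t| → f t = 0) (hm : ∀ k : ℕ, ∫ t, ((t ^ k : ℝ) : ℂ) * f t = 0) : f = 0 := by
  have hcs : HasCompactSupport f := hasCompactSupport_of_abs hR
  have hint : ∀ k : ℕ, Integrable (fun t => ((t ^ k : ℝ) : ℂ) * f t) := fun k =>
    Continuous.integrable_of_hasCompactSupport (by fun_prop) hcs.mul_left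
  have hre := eq_zero_of_moments_eq_zero_real (f := fun t => (f t).re) (R := R) (by fun_prop)
    (fun t ht => by simp [hR t ht]) fun k => by
      have := integral_re (hint k)
      rw [hm] at this
      simpa only [RCLike.re_eq_complex_re, Complex.re_ofReal_mul, Complex.zero_re] using this
  have him := eq_zero_of_moments_eq_zero_real (f := fun t => (f t).im) (R := R) (by fun_prop)
    (fun t ht => by simp [hR t ht]) fun k => by
      have := integral_im (hint k)
      rw [hm] at this
      simpa only [RCLike.im_eq_complex_im, Complex.im_ofReal_mul, Complex.zero_im] using this
  funext t
  exact Complex.ext (congrFun hre t) (congrFun him t)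

end Moments

/-! ### Removing the time shift from the leading moment. -/

section MomentFubini

open MeasureTheory Filter Topology

/-- The first non-vanishing moment of a function is invariant under translations. -/
lemma integral_pow_mul_shift {φ : ℝ → ℂ} (hφ : Continuous φ) {R : ℝ}
    (hR : ∀ t, R < |t| → φ t = 0) {k : ℕ}
    (hm : ∀ m < k, ∫ t, ((t ^ m : ℝ) : ℂ) * φ t = 0) (h : ℝ) :
    ∫ t, ((t ^ k : ℝ) : ℂ) * φ (t + h) = ∫ t, ((t ^ k : ℝ) : ℂ) * φ t := by
  have hint : ∀ m : ℕ, Integrable (fun t => ((t ^ m : ℝ) : ℂ) * φ t) := fun m =>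
    Continuous.integrable_of_hasCompactSupport (by fun_prop) (hasCompactSupport_of_abs hR).mul_left
  have h1 := integral_add_right_eq_self (μ := volume)
    (fun t => (((t - h) ^ k : ℝ) : ℂ) * φ t) h
  simp only [add_sub_cancel_right] at h1
  rw [h1]
  -- Binomial expansion: the terms with `m < k` integrate to zero, and the term `m = k` has
  -- coefficient `1`.
  have e : ∀ t : ℝ, (((t - h) ^ k : ℝ) : ℂ) * φ t = ∑ m ∈ Finset.range (k + 1),
      (((-h) ^ (k - m) * (k.choose m : ℝ) : ℝ) : ℂ) * (((t ^ m : ℝ) : ℂ) * φ t) := by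
    intro t
    rw [sub_eq_add_neg, add_pow, Complex.ofReal_sum, Finset.sum_mul]
    refine Finset.sum_congr rfl fun m _ => ?_
    push_cast
    ring
  simp only [e]
  rw [integral_finsetSum _ fun m _ => (hint m).const_mul _, Finset.sum_range_succ]
  rw [Finset.sum_eq_zero fun m hmk => by
    rw [integral_const_mul, hm m (Finset.mem_range.1 hmk), mul_zero]]
  simp

variable {N : ℕ}

lemma matrix_conj_apply (A B C : Mat N) (i j : Fin N) :
    (A * B * C) i j = ∑ b, ∑ a, A i a * B a b * C b j := by
  simp [Matrix.mul_apply, Finset.sum_mul]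

/-- If the integrals of the translates in `t` of a conjugated family `q t s` vanish, then so does
the integral of its first non-vanishing moment in `t`. -/
lemma integral_moment_eq_zero {κ : ℝ} (hκ : 0 ≤ κ) {q : ℝ → ℝ → Mat N} {A P : ℝ → Mat N}
    {h : ℝ → ℝ} {R : ℝ}
    (hq : ContinuousOn (fun z : ℝ × ℝ => q z.1 z.2) (univ ×ˢ Icc 0 κ))
    (hR : ∀ t s, R < |t| → q t s = 0) (hA : ContinuousOn A (Icc 0 κ))
    (hP : ContinuousOn P (Icc 0 κ)) (hh : ContinuousOn h (Icc 0 κ)) {k : ℕ}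
    (hm : ∀ m < k, ∀ s ∈ Icc 0 κ, ∀ a b, ∫ t, ((t ^ m : ℝ) : ℂ) * q t s a b = 0) (i j : Fin N)
    (hvan : ∀ t₀ : ℝ, ∫ s in (0 : ℝ)..κ, (A s * q (t₀ + h s) s * P s) i j = 0) :
    ∫ s in (0 : ℝ)..κ,
      (A s * (Matrix.of fun a b => ∫ t, ((t ^ k : ℝ) : ℂ) * q t s a b) * P s) i j = 0 := by
  obtain ⟨C, hC⟩ := isCompact_Icc.bddAbove_image hh.abs
  have hC' : ∀ s ∈ Icc 0 κ, |h s| ≤ C := fun s hs => hC ⟨s, hs, rfl⟩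
  -- Beyond `T` all translates `q (t + h s) s` vanish, uniformly in `s`, so Fubini is applied on a
  -- compact rectangle.
  set T := R + C with hT
  set G : ℝ → ℝ → ℂ := fun t s => ((t ^ k : ℝ) : ℂ) * (A s * q (t + h s) s * P s) i j with hG
  have hzero : ∀ s ∈ Icc 0 κ, ∀ t, T < |t| → q (t + h s) s = 0 := by
    intro s hs t ht
    refine hR _ _ ?_
    have h1 := abs_sub_abs_le_abs_sub t (-h s)
    rw [abs_neg, sub_neg_eq_add] at h1
    linarith [hC' s hs]
  have hGc : ContinuousOn (fun z : ℝ × ℝ => G z.1 z.2) (univ ×ˢ Icc 0 κ) := by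
    have hsnd : ContinuousOn (fun z : ℝ × ℝ => z.2) (univ ×ˢ Icc 0 κ) := continuousOn_snd
    have hmaps : MapsTo (fun z : ℝ × ℝ => z.2) (univ ×ˢ Icc 0 κ) (Icc 0 κ) := fun z hz => hz.2
    have h1 : ContinuousOn (fun z : ℝ × ℝ => q (z.1 + h z.2) z.2) (univ ×ˢ Icc 0 κ) :=
      hq.comp (f := fun z : ℝ × ℝ => (z.1 + h z.2, z.2))
        ((continuousOn_fst.add (hh.comp hsnd hmaps)).prodMk hsnd) fun z hz => ⟨trivial, hz.2⟩
    have h2 : ContinuousOn (fun z : ℝ × ℝ => A z.2 * q (z.1 + h z.2) z.2 * P z.2)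
        (univ ×ˢ Icc 0 κ) := ((hA.comp hsnd hmaps).mul h1).mul (hP.comp hsnd hmaps)
    have h3 : ContinuousOn (fun z : ℝ × ℝ => ((z.1 ^ k : ℝ) : ℂ)) (univ ×ˢ Icc 0 κ) := by fun_prop
    exact h3.mul (continuousOn_pi.1 (continuousOn_pi.1 h2 i) j)
  have hGi : Integrable (Function.uncurry G)
      ((volume.restrict (Icc (-T) T)).prod (volume.restrict (Icc 0 κ))) := by
    rw [Measure.prod_restrict]
    exact (hGc.mono (prod_mono (subset_univ _) subset_rfl)).integrableOn_compact
      (isCompact_Icc.prod isCompact_Icc)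
  have hswap := integral_integral_swap hGi
  -- For fixed `t` the inner integral is `t ^ k` times the integral in `hvan` with `t₀ = t`.
  have hleft : ∫ t in Icc (-T) T, ∫ s in Icc 0 κ, G t s = 0 := by
    refine integral_eq_zero_of_ae (Eventually.of_forall fun t => ?_)
    simp only [hG, integral_const_mul, Pi.zero_apply]
    rw [integral_Icc_eq_integral_Ioc, ← intervalIntegral.integral_of_le hκ, hvan, mul_zero]
  rw [hleft] at hswap
  rw [intervalIntegral.integral_of_le hκ, ← integral_Icc_eq_integral_Ioc, hswap]
  refine setIntegral_congr_fun measurableSet_Icc fun s hs => ?_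
  have hqc : ∀ a b, Continuous (fun t => q t s a b) := fun a b => by
    have h1 : ContinuousOn (fun t => q t s) univ :=
      hq.comp (f := fun t : ℝ => (t, s)) (by fun_prop) fun t _ => ⟨trivial, hs⟩
    have h2 := continuousOn_univ.1 h1
    exact (continuous_apply b).comp ((continuous_apply a).comp h2)
  have hsupp : ∫ t in Icc (-T) T, G t s = ∫ t, G t s := by
    refine setIntegral_eq_integral_of_forall_compl_eq_zero fun t ht => ?_
    have ht' : T < |t| := by
      by_contra hcon
      exact ht (abs_le.1 (not_lt.1 hcon))
    simp [hG, hzero s hs t ht']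
  have hint : ∀ a b, Integrable (fun t => ((t ^ k : ℝ) : ℂ) * q (t + h s) s a b) := fun a b =>
    Continuous.integrable_of_hasCompactSupport
      ((by fun_prop : Continuous fun t : ℝ => ((t ^ k : ℝ) : ℂ)).mul
        ((hqc a b).comp (continuous_add_const (h s))))
      (hasCompactSupport_of_abs (R := T) fun t ht => by simp [hzero s hs t ht]).mul_left
  have e : ∀ t, G t s = ∑ b, ∑ a, A s i a * (((t ^ k : ℝ) : ℂ) * q (t + h s) s a b) * P s b j := by
    intro t
    simp only [hG, matrix_conj_apply, Finset.mul_sum]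
    refine Finset.sum_congr rfl fun b _ => Finset.sum_congr rfl fun a _ => ?_
    ring
  change _ = ∫ t in Icc (-T) T, G t s
  rw [hsupp]
  simp only [e]
  rw [matrix_conj_apply, integral_finsetSum _ fun b _ => integrable_finsetSum _ fun a _ =>
    ((hint a b).const_mul _).mul_const _]
  refine Finset.sum_congr rfl fun b _ => ?_
  rw [integral_finsetSum _ fun a _ => ((hint a b).const_mul _).mul_const _]
  refine Finset.sum_congr rfl fun a _ => ?_
  rw [integral_mul_const, integral_const_mul,
    integral_pow_mul_shift (hqc a b) (R := R) (fun t ht => by simp [hR t s ht])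
      (fun m hmk => hm m hmk s hs a b)]
  rfl

end MomentFubini

/-! ### Support and smoothness of the time moments. -/

section SmoothMoments

open MeasureTheory Filter Topology Convolution

variable {n : ℕ} [NeZero n] {M : Type*} [TopologicalSpace M]
  [ChartedSpace (EuclideanHalfSpace n) M] [IsManifold (𝓡∂ n) ∞ M] {N : ℕ}

/-- The `k`-th moment in time of a matrix-valued function on `ℝ × M`. -/
def moment (Q : ℝ × M → Mat N) (k : ℕ) (x : M) : Mat N :=
  Matrix.of fun i j => ∫ t, ((t ^ k : ℝ) : ℂ) * Q (t, x) i j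

lemma exists_time_bound {Q : ℝ × M → Mat N} (hc : HasCompactSupport Q) :
    ∃ R : ℝ, ∀ t x, R < |t| → Q (t, x) = 0 := by
  obtain ⟨R, hR⟩ := (hc.isCompact.image continuous_fst).isBounded.exists_norm_le
  refine ⟨R, fun t x ht => ?_⟩
  by_contra hne
  exact absurd (hR t ⟨(t, x), subset_tsupport _ hne, rfl⟩) (not_le.2 ht)

lemma moment_eq_zero_of_notMem {Q : ℝ × M → Mat N} (k : ℕ) {x : M}
    (hx : x ∉ Prod.snd '' tsupport Q) : moment Q k x = 0 := by
  ext i j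
  have : ∀ t, Q (t, x) = 0 := fun t => by
    by_contra hne
    exact hx ⟨(t, x), subset_tsupport _ hne, rfl⟩
  simp [moment, this]

/-- The projected support is compact, hence closed because `M` is Hausdorff. -/
lemma tsupport_moment_subset [T2Space M] {Q : ℝ × M → Mat N} (hc : HasCompactSupport Q) (k : ℕ) :
    tsupport (moment Q k) ⊆ Prod.snd '' tsupport Q := by
  refine closure_minimal (fun x hx => ?_) (hc.isCompact.image continuous_snd).isClosed
  by_contra hcon
  exact hx (moment_eq_zero_of_notMem k hcon)

/-- The moment is the convolution in `t` of `t ^ k` with the time-reversed `Q`, evaluated at `0`;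
convolution with a compactly supported smooth family is smooth in the parameter. The interior of the
target provides an open parameter set. -/
lemma contDiffOn_moment_symm {Q : ℝ × M → Mat N} (hQ : IsSmoothMat (cylModel n) Q)
    (hc : HasCompactSupport Q) (k : ℕ) (x : M) (i j : Fin N) :
    ContDiffOn ℝ ∞ (fun y => moment Q k ((extChartAt (𝓡∂ n) x).symm y) i j)
      (interior (extChartAt (𝓡∂ n) x).target) := by
  obtain ⟨R, hR⟩ := exists_time_bound hc
  set S := interior (extChartAt (𝓡∂ n) x).target with hS
  have hsmooth : ContDiffOn ℝ ((⊤ : ℕ∞) : WithTop ℕ∞)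
      (Function.HasUncurry.uncurry fun (y : EuclideanSpace ℝ (Fin n)) (t : ℝ) =>
        Q (-t, (extChartAt (𝓡∂ n) x).symm y) i j) (S ×ˢ univ) := by
    rw [← contMDiffOn_iff_contDiffOn]
    have h1 : ContMDiffOn 𝓘(ℝ, EuclideanSpace ℝ (Fin n) × ℝ) (𝓡∂ n) ∞
        (fun z : EuclideanSpace ℝ (Fin n) × ℝ => (extChartAt (𝓡∂ n) x).symm z.1) (S ×ˢ univ) :=
      (contMDiffOn_extChartAt_symm x).comp contDiff_fst.contMDiff.contMDiffOn
        fun z hz => show z.1 ∈ (extChartAt (𝓡∂ n) x).target from interior_subset hz.1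
    have h2 : ContMDiffOn 𝓘(ℝ, EuclideanSpace ℝ (Fin n) × ℝ) 𝓘(ℝ, ℝ) ∞
        (fun z : EuclideanSpace ℝ (Fin n) × ℝ => -z.2) (S ×ˢ univ) :=
      contDiff_snd.neg.contMDiff.contMDiffOn
    exact (hQ i j).comp_contMDiffOn (h2.prodMk h1)
  have hconv := contDiffOn_convolution_right_with_param (𝕜 := ℝ) (μ := volume)
    (f := fun t : ℝ => ((t ^ k : ℝ) : ℂ)) (ContinuousLinearMap.mul ℝ ℂ) (k := Icc (-R) R)
    isOpen_interior isCompact_Icc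
    (fun y t _ ht => by
      rw [hR _ _ (by
        rw [abs_neg]
        by_contra hcon
        exact ht (abs_le.1 (not_lt.1 hcon)))]
      rfl)
    (Continuous.locallyIntegrable (by fun_prop)) hsmooth
  refine (hconv.comp (f := fun y => (y, (0 : ℝ))) (contDiff_id.prodMk contDiff_const).contDiffOn
    fun y hy => ⟨hy, trivial⟩).congr fun y _ => ?_
  simp [convolution, moment]

/-- Points of the projected support are interior, so the chart computation applies there; at any
other point the moment vanishes nearby. -/
lemma isSmoothMat_moment [T2Space M] {Q : ℝ × M → Mat N} (hQ : IsSmoothMat (cylModel n) Q)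
    (hc : HasCompactSupport Q) (hs : tsupport Q ⊆ univ ×ˢ (𝓡∂ n).interior M) (k : ℕ) :
    IsSmoothMat (𝓡∂ n) (moment Q k) := by
  intro i j x
  by_cases hx : x ∈ Prod.snd '' tsupport Q
  · obtain ⟨z, hz, rfl⟩ := hx
    have hint : z.2 ∈ (𝓡∂ n).interior M := (hs hz).2
    have hmem := (𝓡∂ n).isInteriorPoint_iff.1 hint
    have h1 := ((contDiffOn_moment_symm hQ hc k z.2 i j).contDiffAt
      (isOpen_interior.mem_nhds hmem)).contMDiffAt
    have h2 := h1.comp z.2 (contMDiffAt_extChartAt (I := 𝓡∂ n) (x := z.2) (n := ∞))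
    refine h2.congr_of_eventuallyEq ?_
    filter_upwards [extChartAt_source_mem_nhds (I := 𝓡∂ n) z.2] with x' hx'
    simp only [Function.comp]
    rw [(extChartAt (𝓡∂ n) z.2).left_inv hx']
  · refine (contMDiffAt_const (c := (0 : ℂ))).congr_of_eventuallyEq ?_
    filter_upwards [(hc.isCompact.image continuous_snd).isClosed.isOpen_compl.mem_nhds hx]
      with x' hx'
    rw [moment_eq_zero_of_notMem k hx']
    rfl

end SmoothMoments

/-! ### From light rays to the magnetic X-ray transform. -/

section Reduction

open MeasureTheory Filter Topology

variable {n : ℕ} [NeZero n] {M : Type*} [TopologicalSpace M]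
  [ChartedSpace (EuclideanHalfSpace n) M] [IsManifold (𝓡∂ n) ∞ M]
  {g : Metric n M} {om : SmoothOneForm (𝓡∂ n) (M := M) ℝ} {N : ℕ} {Φ : M → Mat N}
  {A : Fin N → Fin N → SmoothOneForm (𝓡∂ n) (M := M) ℂ}

/-- Continuity of the velocity comes from the acceleration condition, which makes its components
differentiable. -/
lemma IsMagneticGeodesic.continuousOn_form {F : Type*} [NormedAddCommGroup F] [NormedSpace ℝ F]
    (θ : SmoothOneForm (𝓡∂ n) (M := M) F) {a b : ℝ} {γ : ℝ → TangentBundle (𝓡∂ n) M}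
    (h : IsMagneticGeodesic g om a b γ) :
    ContinuousOn (fun s => θ.toForm (γ s).proj (γ s).2) (Icc a b) := fun s hs => by
  obtain ⟨acc, h1, -⟩ := h.2.2 s hs
  exact (θ.hasDerivWithinAt_velocity h.1 hs h1).continuousWithinAt

lemma IsMagneticGeodesic.continuousOn_attenuation (hΦ : IsSmoothMat (𝓡∂ n) Φ) {a b : ℝ}
    {γ : ℝ → TangentBundle (𝓡∂ n) M} (h : IsMagneticGeodesic g om a b γ) (i j : Fin N) :
    ContinuousOn (fun s => attenuation om Φ A (γ s) i j) (Icc a b) := by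
  have h1 : ContinuousOn (fun s => Φ (γ s).proj i j) (Icc a b) :=
    (hΦ i j).continuous.comp_continuousOn h.1.continuousOn
  exact h1.add ((h.continuousOn_form (A i j)).sub ((h.continuousOn_form om).smul h1))

/-- The lift has time component `1 - ω(ẋ)`, which accounts for the correction `-ωΦ` in the
attenuation. Both transforms therefore use the same transport equation. -/
lemma connection_nullLift (τ : ℝ → ℝ) (γ : ℝ → TangentBundle (𝓡∂ n) M) (s : ℝ) :
    connection Φ A (nullLift om τ γ s) = attenuation om Φ A (γ s) := by
  unfold connection attenuation
  rw [timePart_eq, spacePart_eq]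
  change (1 - om.toForm (γ s).proj (γ s).2) • Φ (γ s).proj + matrixForm A (γ s).proj (γ s).2 = _
  rw [sub_smul, one_smul]
  abel

/-- A function on an interval `[0, κ]` has a continuous antiderivative. -/
lemma exists_hasDerivWithinAt_of_continuousOn {f : ℝ → ℝ} {κ : ℝ} (hκ : 0 ≤ κ)
    (hf : ContinuousOn f (Icc 0 κ)) :
    ∃ h : ℝ → ℝ, Continuous h ∧ ∀ s ∈ Icc 0 κ, HasDerivWithinAt h (f s) (Icc 0 κ) s := by
  -- Extending `f` by its endpoint values makes it continuous on all of `ℝ`, so the fundamental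
  -- theorem of calculus also covers the endpoints.
  have hc : Continuous (IccExtend hκ ((Icc 0 κ).domRestrict f)) := hf.domRestrict.Icc_extend'
  have hd : ∀ s, HasDerivAt (fun s => ∫ r in (0 : ℝ)..s, IccExtend hκ ((Icc 0 κ).domRestrict f) r)
      (IccExtend hκ ((Icc 0 κ).domRestrict f) s) s := fun s =>
    intervalIntegral.integral_hasDerivAt_right (hc.intervalIntegrable _ _)
      hc.aestronglyMeasurable.stronglyMeasurableAtFilter hc.continuousAt
  refine ⟨_, continuous_iff_continuousAt.2 fun s => (hd s).continuousAt, fun s hs => ?_⟩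
  have h1 := (hd s).hasDerivWithinAt (s := Icc 0 κ)
  rwa [IccExtend_of_mem _ _ hs] at h1

/-- The null lift of a maximal magnetic geodesic is maximal. -/
lemma isMaximalCurve_nullLift {a b : ℝ} {γ : ℝ → TangentBundle (𝓡∂ n) M}
    (h : IsMaximalCurve (IsMagneticGeodesic g om) a b γ) {τ : ℝ → ℝ}
    (hτ : ∀ s ∈ Icc a b, HasDerivWithinAt τ (1 - om.toForm (γ s).proj (γ s).2) (Icc a b) s) :
    IsMaximalCurve (IsNullGeodesic g om) a b (nullLift om τ γ) := by
  obtain ⟨hab, hγ, hmax⟩ := h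
  refine ⟨hab, hγ.isNullGeodesic hτ, fun a' b' γ' ha hb hγ' heq => ?_⟩
  have ha0 : a ∈ Icc a b := ⟨le_rfl, hab⟩
  -- A continuation agrees with the lift at `a`, so it has `dt + ω = 1` there; its projection is
  -- then a magnetic geodesic continuing `γ`.
  refine hmax a' b' (fun r => spaceLift (γ' r)) ha hb
    (hγ'.isMagneticGeodesic (s₀ := a) ⟨ha, hab.trans hb⟩ ?_) fun s hs => ?_
  · rw [← heq ha0]
    exact dtAddOmega_nullLift τ γ a
  · change γ s = spaceLift (γ' s)
    rw [← heq hs]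
    rfl

/-- The first non-vanishing time moment of a function in the kernel of the light ray transform is
in the kernel of the magnetic X-ray transform. -/
lemma LightRayVanishes.xRayVanishes_moment (hconv : StrictlyMagneticConvex g om)
    (hΦ : IsSmoothMat (𝓡∂ n) Φ) {Q : ℝ × M → Mat N} (hQ : IsSmoothMat (cylModel n) Q)
    (hc : HasCompactSupport Q) (hL : LightRayVanishes g om Φ A Q) {k : ℕ}
    (hk : ∀ m < k, moment Q m = 0) : XRayVanishes g om Φ A (moment Q k) := by
  rintro z ⟨hb, -, hn⟩ σ κ γ P hσ hκ hmax rfl hP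
  ext i j
  have hgeo := hmax.2.1
  rcases hn.lt_or_eq with hpos | hzero
  · obtain rfl := hgeo.1.eq_zero_of_normalComponent_pos hσ hκ hb hpos
    have hα := hgeo.continuousOn_attenuation (A := A) hΦ
    -- `h` is the time elapsed along the null lift up to an additive constant, which the arbitrary
    -- `t₀` absorbs.
    obtain ⟨h, hh, hhd⟩ := exists_hasDerivWithinAt_of_continuousOn hκ
      (continuousOn_const (c := (1 : ℝ)).sub (hgeo.continuousOn_form om))
    obtain ⟨R, hR⟩ := exists_time_bound hc
    have hQc : Continuous Q := continuous_pi fun a => continuous_pi fun b => (hQ a b).continuous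
    refine integral_moment_eq_zero hκ (q := fun t s => Q (t, (γ s).proj)) (h := h) (R := R)
      (hQc.comp_continuousOn (continuousOn_fst.prodMk
        (hgeo.1.continuousOn.comp continuousOn_snd fun z hz => hz.2)))
      (fun t s ht => hR t _ ht) (hP.continuousOn_inv hα) hP.continuousOn hh.continuousOn
      (fun m hm s _ a b => congrFun (congrFun (congrFun (hk m hm) (γ s).proj) a) b) i j
      fun t₀ => ?_
    have hlift := isMaximalCurve_nullLift hmax (τ := fun s => t₀ + h s)
      fun s hs => (hhd s hs).const_add t₀
    have hP' : IsParallelTransport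
        (fun s => connection Φ A (nullLift om (fun s => t₀ + h s) γ s)) κ P := by
      simpa only [connection_nullLift] using hP
    exact congrFun (congrFun (hL κ _ P hlift hP') i) j
  · obtain rfl := hgeo.eq_zero_of_normalComponent_eq_zero hconv hσ hκ hb hzero.symm
    simp [conjIntegral]

end Reduction

end LightRay

end

/-! ### Induction over the moments and conclusion. -/

theorem mainTheorem3 {n : ℕ} [NeZero n] {M : Type*} [TopologicalSpace M] [T2Space M]
    [CompactSpace M] [ChartedSpace (EuclideanHalfSpace n) M] [IsManifold (𝓡∂ n) ∞ M]
    (g : LightRay.Metric n M) (om : LightRay.SmoothOneForm (𝓡∂ n) (M := M) ℝ)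
    (hconv : LightRay.StrictlyMagneticConvex g om) (hnt : LightRay.NonTrapping g om)
    {N : ℕ} (Φ : M → LightRay.Mat N) (hΦ : LightRay.IsSmoothMat (𝓡∂ n) Φ)
    (A : Fin N → Fin N → LightRay.SmoothOneForm (𝓡∂ n) (M := M) ℂ)
    (hI : LightRay.XRayInjective g om Φ A) :
    LightRay.LightRayInjective g om Φ A := by
  intro Q hQ hc hs hL
  have hmom : ∀ k, LightRay.moment Q k = 0 := by
    intro k
    induction k using Nat.strong_induction_on with
    | _ k ih =>
      refine hI _ (LightRay.isSmoothMat_moment hQ hc hs k)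
        (HasCompactSupport.of_compactSpace _) ?_
        (hL.xRayVanishes_moment hconv hΦ hQ hc ih)
      refine (LightRay.tsupport_moment_subset hc k).trans ?_
      rintro _ ⟨z, hz, rfl⟩
      exact (hs hz).2
  obtain ⟨R, hR⟩ := LightRay.exists_time_bound hc
  funext z
  ext i j
  have hcont : Continuous fun t : ℝ => Q (t, z.2) i j :=
    (hQ i j).continuous.comp (Continuous.prodMk_left z.2)
  have h0 := LightRay.eq_zero_of_moments_eq_zero hcont (R := R)
    (fun t ht => by simp [hR t z.2 ht])
    fun k => congrFun (congrFun (congrFun (hmom k) z.2) i) j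
  exact congrFun h0 z.1
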